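/- **Conventions.** An index is a non-empty finite range $I=\{i,i+1,\dots,j\}\subseteq\mathbb N$ of priorities. A sequence of priorities is parity accepting if its $\limsup$ is even. A parity game has edges labelled by priorities and vertices owned by Eve or Adam. Eve wins it if she has a strategy from the initial vertex that always provides a legal move when it is her turn (so she loses when she is stuck) and all of whose infinite plays have a parity accepting sequence of labels. Let $\Sigma$ be a finite non-empty alphabet. A $\Sigma$-tree is a map $t:\{0,1\}^*\to\Sigma$. A nondeterministic parity tree automaton $A$ of index $I$ has a finite state set $Q_A$, an initial state $q_A$, transitions $\Delta_A\subseteq Q_A\times\Sigma\times Q_A\times Q_A$ and priorities $\Omega_A:\Delta_A\to I^2$. It is complete if every state has a transition over every letter. In the acceptance game $\mathcal G(A,t)$, which starts at $(\varepsilon,q_A)$, Eve moves from $(w,q)$ to $(w,e)$ for some $e=(q,t(w),q_0,q_1)\in\Delta_A$ (label $\min I$), and then Adam moves from $(w,e)$ to $(w0,q_0)$ or $(w1,q_1)$ (the label is the first or the second component of $\Omega_A(e)$, respectively). $L(A)$ is the set of trees $t$ such that Eve wins $\mathcal G(A,t)$. A set of trees is $J$-feasible if it equals $L(B)$ for some automaton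 $B$ of index $J$, not necessarily complete. A guiding function from $B$ to $A$ is a map $g:Q_A\times\Delta_B\to\Delta_A$ such that $g(p,(q,a,q_0,q_1))$ is a transition from $p$ over $a$. It maps each run $\rho$ of $B$ on a tree $t$ to a run $g(\rho)$ of $A$ on $t$: start in $q_A$ at the root, and at each node apply $g$ to the current state of $A$ and the transition of $\rho$ there. $B$ guides $A$ if some guiding function maps every accepting run of $B$ to an accepting run of $A$. $A$ is guidable if every complete automaton $B$ (of any index) with $L(B)=L(A)$ guides $A$. **The priority transduction game.** Let $\mathcal G$ be a parity game of index $I$, let $J$ be an index and $n\in\mathbb N$. The game $\mathrm{Reg}_J^n(\mathcal G)$ has a register $r_j$, holding a value in $I$, for each $j$ with $2j\in J$, and also one for $j=(\min J-1)/2$ if $\min J$ is odd. It has counters $c_{i,j}\in\{0,\dots,n\}$ for $i\in I$ odd and $r_j$ a register. Initially the counters are $0$ and the registers hold the greatest even priority of $I$ (or the only priority of $I$, if $I$ consists of one odd number). Each step is as follows. 1. The owner of the current vertex of $\mathcal G$ chooses an edge $e$ from it, with label $L(e)$. 2. Eve chooses a register $r_j$, which gives an output $w$. If $2j<\min J$,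 then $w=2j+1=\min J$. Otherwise, if $r_j$ is even, $w=2j$. Otherwise, if $c_{r_j,j}<n$, then $w=2j$ and $c_{r_j,j}$ is incremented. Otherwise $w=2j+1$ and $c_{r_j,j}$ is set to $0$; if $2j+1\notin J$, Eve loses at once. 3. If $L(e)$ is even, let $i=L(e)$; otherwise Eve chooses an odd $i\in I$ with $i\ge L(e)$. The counters $c_{i',j}$ for $i'<i$ and the counters $c_{r_j,j'}$ for $j'<j$ are set to $0$ (here $r_j$ is the old content). Then $r_j:=i$, and $r_{j'}:=\max(i,r_{j'})$ for every $j'>j$. Eve wins if the infinite sequence of outputs is parity accepting. **Theorem.** Let $A$ be a complete guidable nondeterministic parity tree automaton over $\Sigma$ and let $J$ be an index. The following are equivalent: - $L(A)$ is $J$-feasible; - there is $n\in\mathbb N$ such that for every $\Sigma$-tree $t$: $t\in L(A)$ if and only if Eve wins $\mathrm{Reg}_J^n(\mathcal G(A,t))$. Moreover, if $J$ does not consist of a single even priority, then these are also equivalent to: $L(A)=L(B)$ for some complete automaton $B$ of index $J$. -/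

import Mathlib

/-- An index: a non-empty finite range `{lo, lo + 1, …, hi}` of natural numbers. -/
structure Index where
  lo : ℕ
  hi : ℕ
  lo_le_hi : lo ≤ hi

namespace Index

/-- The priorities of an index. -/
abbrev Priority (I : Index) : Type := Set.Icc I.lo I.hi

/-- The greatest even priority of `I`. (If `I` consists of a single odd number, there is no even
priority, and the only priority of `I` is used instead.) -/
def maxEven (I : Index) : I.Priority :=
  if Even I.hi then ⟨I.hi, I.lo_le_hi, le_rfl⟩
  else if h : I.lo < I.hi then ⟨I.hi - 1, Nat.le_sub_one_of_lt h, Nat.sub_le _ _⟩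
  else ⟨I.hi, I.lo_le_hi, le_rfl⟩

end Index

/-- A sequence of priorities is parity accepting if the greatest value that it takes infinitely
often (its limsup) is even. -/
def ParityAccepting (c : ℕ → ℕ) : Prop :=
  ∃ m, Even m ∧ (∃ᶠ n in Filter.atTop, c n = m) ∧ ∀ᶠ n in Filter.atTop, c n ≤ m

/-! ### Parity games -/

/-- A parity game of index `I` on the set of vertices `V`, with an initial vertex. The vertices
outside `eve` belong to Adam. Only the labels of edges are meaningful. -/
structure ParityGame (V : Type*) (I : Index) where
  init : V
  eve : V → Prop
  edge : V → V → Prop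
  label : V → V → ℕ
  label_mem : ∀ u v, edge u v → label u v ∈ Set.Icc I.lo I.hi

namespace ParityGame

variable {V : Type*} {I : Index}

/-- The vertices visited by the play `p` up to time `n`, in order. -/
def history (p : ℕ → V) (n : ℕ) : List V := (List.range (n + 1)).map p

/-- The first `n` moves of `p` form a play from the initial vertex in which Eve follows `σ`. -/
def ConsistentUpTo (G : ParityGame V I) (σ : List V → V) (p : ℕ → V) (n : ℕ) : Prop :=
  p 0 = G.init ∧
    ∀ k < n, G.edge (p k) (p (k + 1)) ∧ (G.eve (p k) → p (k + 1) = σ (history p k))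

/-- `σ` is a winning strategy for Eve: it proposes a legal move whenever it is Eve's turn after
a finite play consistent with `σ` (so Eve loses when she cannot move), and every infinite play
consistent with `σ` is parity accepting. -/
def IsWinningStrategy (G : ParityGame V I) (σ : List V → V) : Prop :=
  (∀ p n, G.ConsistentUpTo σ p n → G.eve (p n) → G.edge (p n) (σ (history p n))) ∧
    ∀ p, (∀ n, G.ConsistentUpTo σ p n) → ParityAccepting fun n => G.label (p n) (p (n + 1))

/-- Eve wins the game from its initial vertex. -/
def EveWins (G : ParityGame V I) : Prop := ∃ σ : List V → V, G.IsWinningStrategy σ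

end ParityGame

/-! ### Trees and automata -/

/-- A labelled infinite binary tree `{0,1}* → α`; `false` is the direction `0`, `true` is `1`. -/
abbrev LTree (α : Type*) := List Bool → α

/-- A nondeterministic parity tree automaton of index `I` over the alphabet `α`.
A transition is a tuple `(q, a, q₀, q₁)`; `prio e b` is the priority of `e` in direction `b`. -/
structure TreeAutomaton (α : Type*) (I : Index) where
  Q : Type
  finite_Q : Finite Q
  init : Q
  trans : Set (Q × α × Q × Q)
  prio : trans → Bool → I.Priority

namespace TreeAutomaton

variable {α : Type*} {I K : Index}

/-- The state from which a transition starts. -/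
def src (A : TreeAutomaton α I) (e : A.trans) : A.Q := e.1.1

/-- The letter of a transition. -/
def letter (A : TreeAutomaton α I) (e : A.trans) : α := e.1.2.1

/-- The state to which a transition leads in direction `b`. -/
def child (A : TreeAutomaton α I) (e : A.trans) (b : Bool) : A.Q :=
  if b then e.1.2.2.2 else e.1.2.2.1

/-- Every state has a transition over every letter. -/
def IsComplete (A : TreeAutomaton α I) : Prop :=
  ∀ q a, ∃ e : A.trans, A.src e = q ∧ A.letter e = a

/-- The edges of the acceptance game: Eve chooses a transition from the current state over the
current letter, then Adam chooses a direction. -/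
def gameEdge (A : TreeAutomaton α I) (t : LTree α) :
    List Bool × (A.Q ⊕ A.trans) → List Bool × (A.Q ⊕ A.trans) → Prop
  | (w, .inl q), (w', .inr e) => w' = w ∧ A.src e = q ∧ A.letter e = t w
  | (w, .inr e), (w', .inl q) => ∃ b, w' = w ++ [b] ∧ q = A.child e b
  | _, _ => False

/-- The labels of the acceptance game: the least priority for Eve's moves, the priorities of the
transition for Adam's moves. -/
def gameLabel (A : TreeAutomaton α I) :
    List Bool × (A.Q ⊕ A.trans) → List Bool × (A.Q ⊕ A.trans) → ℕ
  | (w, .inr e), (w', _) => if w' = w ++ [true] then A.prio e true else A.prio e false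
  | (_, .inl _), _ => I.lo

/-- The acceptance game of the automaton `A` on the tree `t`. -/
def acceptanceGame (A : TreeAutomaton α I) (t : LTree α) :
    ParityGame (List Bool × (A.Q ⊕ A.trans)) I where
  init := ([], .inl A.init)
  eve v := v.2.isLeft
  edge := A.gameEdge t
  label := A.gameLabel
  label_mem := by
    rintro ⟨w, q | e⟩ ⟨w', x⟩ _
    · exact ⟨le_rfl, I.lo_le_hi⟩
    · simp only [gameLabel]
      split_ifs
      · exact (A.prio e true).2
      · exact (A.prio e false).2

/-- The language of an automaton: the trees on which Eve wins the acceptance game. -/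
def language (A : TreeAutomaton α I) : Set (LTree α) := {t | (A.acceptanceGame t).EveWins}

/-! ### Runs and guidable automata -/

/-- `ρ` is a run of `A` on `t`, seen as a tree of transitions. -/
def IsRun (A : TreeAutomaton α I) (t : LTree α) (ρ : LTree A.trans) : Prop :=
  A.src (ρ []) = A.init ∧ (∀ w, A.letter (ρ w) = t w) ∧
    ∀ w b, A.src (ρ (w ++ [b])) = A.child (ρ w) b

/-- The prefix of length `n` of a branch. -/
def branchPrefix (β : ℕ → Bool) (n : ℕ) : List Bool := (List.range n).map β

/-- `ρ` is an accepting run of `A` on `t`: a run all of whose branches are parity accepting. -/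
def IsAcceptingRun (A : TreeAutomaton α I) (t : LTree α) (ρ : LTree A.trans) : Prop :=
  A.IsRun t ρ ∧
    ∀ β : ℕ → Bool, ParityAccepting fun n => (A.prio (ρ (branchPrefix β n)) (β n) : ℕ)

/-- `g` is a guiding function from `B` to `A`: it is compatible with the given state of `A` and
with the letter of the given transition of `B`. -/
def IsGuidingFunction (A : TreeAutomaton α I) (B : TreeAutomaton α K)
    (g : A.Q → B.trans → A.trans) : Prop :=
  ∀ p e, A.src (g p e) = p ∧ A.letter (g p e) = B.letter e

/-- The state reached at the node `w` when `A` starts in the state `p` at the root and follows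
`g` along `ρ`: the state `p` at the root, and when the state at a node `u` is `q`, the state
at its child in direction `b` is the `b`-th target of `g q (ρ u)`. -/
def guidedState (A : TreeAutomaton α I) (B : TreeAutomaton α K) (g : A.Q → B.trans → A.trans) :
    A.Q → LTree B.trans → List Bool → A.Q
  | p, _, [] => p
  | p, ρ, b :: w => guidedState A B g (A.child (g p (ρ [])) b) (fun u => ρ (b :: u)) w

/-- The run `g(ρ)` of `A` obtained from a run `ρ` of `B`. -/
def guidedRun (A : TreeAutomaton α I) (B : TreeAutomaton α K) (g : A.Q → B.trans → A.trans)
    (ρ : LTree B.trans) : LTree A.trans :=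
  fun w => g (guidedState A B g A.init ρ w) (ρ w)

/-- `B` guides `A`: some guiding function from `B` to `A` preserves acceptance. -/
def Guides (B : TreeAutomaton α K) (A : TreeAutomaton α I) : Prop :=
  ∃ g : A.Q → B.trans → A.trans, IsGuidingFunction A B g ∧
    ∀ t ρ, B.IsAcceptingRun t ρ → A.IsAcceptingRun t (guidedRun A B g ρ)

/-- `A` is guidable: it is guided by every (complete) automaton, of any index, that recognises
the same language. -/
def IsGuidable (A : TreeAutomaton α I) : Prop :=
  ∀ (K : Index) (B : TreeAutomaton α K), B.IsComplete → B.language = A.language → B.Guides A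

end TreeAutomaton

/-- `L` is recognised by a (possibly incomplete) nondeterministic automaton of index `J`. -/
def Feasible {α : Type*} (J : Index) (L : Set (LTree α)) : Prop :=
  ∃ B : TreeAutomaton α J, B.language = L

/-- `L` is recognised by a complete nondeterministic automaton of index `J`. -/
def CompletelyFeasible {α : Type*} (J : Index) (L : Set (LTree α)) : Prop :=
  ∃ B : TreeAutomaton α J, B.IsComplete ∧ B.language = L

/-! ### The priority transduction game -/

/-- The registers for the output index `J`: there is a register `r_j` for every even `2j ∈ J`
and, when the least priority of `J` is odd, one for `2j + 1 = min J`
(so `r₀` exists when `min J = 1`). -/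
abbrev Index.Register (J : Index) : Type :=
  {j : ℕ // 2 * j ∈ Set.Icc J.lo J.hi ∨ 2 * j + 1 = J.lo}

/-- The contents of the registers and of the counters `c_{i,j}`. The counters with `i` even are
never used; they remain `0`. -/
structure RegConfig (I J : Index) (n : ℕ) where
  reg : J.Register → I.Priority
  cnt : I.Priority → J.Register → Fin (n + 1)

namespace RegConfig

variable {I J : Index} {n : ℕ}

/-- Initially the registers hold the greatest even priority and the counters are `0`. -/
def initial (I J : Index) (n : ℕ) : RegConfig I J n where
  reg _ := I.maxEven
  cnt _ _ := 0

/-- The output produced when Eve chooses the register `r_j`. -/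
def output (c : RegConfig I J n) (j : J.Register) : ℕ :=
  if 2 * j.1 < J.lo then 2 * j.1 + 1
  else if Even (c.reg j).1 then 2 * j.1
  else if (c.cnt (c.reg j) j : ℕ) = n then 2 * j.1 + 1
  else 2 * j.1

/-- The counters after the output: if the chosen register `r_j` is not the one for an odd least
priority, and contains an odd value, then the counter `c_{r_j,j}` is incremented, and goes back
to `0` if its value was `n` (addition in `Fin (n + 1)` is modulo `n + 1`). -/
def cntAfterOutput (c : RegConfig I J n) (j : J.Register) (k : I.Priority) (m : J.Register) :
    Fin (n + 1) :=
  if k = c.reg j ∧ m = j ∧ J.lo ≤ 2 * j.1 ∧ Odd (c.reg j).1 then c.cnt k m + 1 else c.cnt k m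

/-- The configuration after a step in which the register `r_j` was chosen and the priority
recorded is `i`. The counters `c_{i',j}` for `i' < i` and `c_{r_j,j'}` for `j' < j` are reset,
`r_j` becomes `i` and `r_{j'}` becomes `max i r_{j'}` for `j' > j`. -/
def update (c : RegConfig I J n) (j : J.Register) (i : I.Priority) : RegConfig I J n where
  reg m := if m = j then i else if j < m then max i (c.reg m) else c.reg m
  cnt k m :=
    if (k < i ∧ m = j) ∨ (k = c.reg j ∧ m < j) then 0 else c.cntAfterOutput j k m

end RegConfig

/-- The priorities that can be recorded after an edge of label `l`: only `l` if `l` is even, any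
odd `i ≥ l` otherwise. -/
def Recordable {I : Index} (l : ℕ) (i : I.Priority) : Prop :=
  if Even l then i.1 = l else Odd i.1 ∧ l ≤ i.1

/-- The positions of the priority transduction game over a game with vertices `V`. -/
inductive RegPos (V : Type*) (I J : Index) (n : ℕ)
  /-- the owner of the vertex chooses an edge of the underlying game -/
  | vertex (u : V) (c : RegConfig I J n)
  /-- the edge from `u` to `v` was taken; Eve chooses a register -/
  | taken (u v : V) (c : RegConfig I J n)
  /-- moreover the register `r_j` was chosen, which produces the output; Eve chooses the priority
  to be recorded -/
  | chosen (u v : V) (c : RegConfig I J n) (j : J.Register)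

namespace RegPos

variable {V : Type*} {I J : Index} {n : ℕ}

/-- The player who moves. -/
def eve (G : ParityGame V I) : RegPos V I J n → Prop
  | vertex u _ => G.eve u
  | _ => True

/-- The moves. If the output is not in `J`, Eve has no move left, and so loses instantly. -/
def edge (G : ParityGame V I) : RegPos V I J n → RegPos V I J n → Prop
  | vertex u c, taken u' v c' => u' = u ∧ c' = c ∧ G.edge u v
  | taken u v c, chosen u' v' c' _ => u' = u ∧ v' = v ∧ c' = c
  | chosen u v c j, vertex v' c' => v' = v ∧ c.output j ∈ Set.Icc J.lo J.hi ∧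
      ∃ i : I.Priority, Recordable (G.label u v) i ∧ c' = c.update j i
  | _, _ => False

/-- The labels: one move per step carries the output of that step; the other ones carry the least
priority of `J`, which does not change the limsup of the sequence of outputs. -/
def label : RegPos V I J n → RegPos V I J n → ℕ
  | chosen _ _ c j, _ => c.output j
  | _, _ => J.lo

end RegPos

/-- The priority transduction game over the parity game `G`, with output index `J` and with
counters bounded by `n`. -/
def Reg (J : Index) (n : ℕ) {V : Type*} {I : Index} (G : ParityGame V I) :
    ParityGame (RegPos V I J n) J where
  init := .vertex G.init (RegConfig.initial I J n)
  eve := RegPos.eve G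
  edge := RegPos.edge G
  label := RegPos.label
  label_mem := by
    rintro (⟨u, c⟩ | ⟨u, v, c⟩ | ⟨u, v, c, j⟩) y h
    · exact ⟨le_rfl, J.lo_le_hi⟩
    · exact ⟨le_rfl, J.lo_le_hi⟩
    · cases y <;> simp only [RegPos.edge] at h
      exact h.2.1

/-! ### Parity accepting sequences -/

/-! Soundness. In the register game, outputs of even limsup force labels of even limsup
(`RegConfig.parityAccepting_of_output`). If the recorded priorities had an odd limsup `p`, the
register `q` behind the dominant even output would hold `p` again and again. Each choice of `q` at
such a moment increments `c_{p,q}`, which nothing resets any more, so it would overflow and produce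
`2q + 1`. There are finitely many configurations, so an automaton of index `J` can guess a run of
`A` together with Eve's register moves and emit the outputs (`regAutomaton`). For every `n` its
language contains all trees on which Eve wins the register game and lies inside `L(A)`. Hence if Eve
wins on all of `L(A)`, then `L(A)` is `J`-feasible.

Completeness. Let `B` have index `J` and recognise `L(A)`. After completing `B` with a rejecting
sink, guidability turns an accepting run of `B` into an accepting run of `A` through a guiding
function. Suppose the pair of states repeats along a branch and the greatest priority of `B` in
between is even. Pumping this loop gives an accepting run of `B`, whose image must accept as well,
so the greatest priority of `A` on the loop is also even (`even_loop_of_guides`). In the register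
game Eve plays the guided run of `A` and chooses the register named by the current priority of `B`,
except that a large even label may go to a greater register. By the loop property, the increments of
a dominant register's counter since its last reset occur at pairwise different states
(`cnt_follow_le`). So a bound depending only on the numbers of states keeps this counter from
overflowing, and the limsup of the outputs is that of the priorities of `B`.

The statement on complete automata follows because an index with an odd priority already has room
for the sink (`completelyFeasible_iff_feasible`). -/

theorem exists_limsup_of_bounded (f : ℕ → ℕ) (B : ℕ) (hB : ∀ᶠ n in Filter.atTop, f n ≤ B) :
    ∃ m, (∃ᶠ n in Filter.atTop, f n = m) ∧ ∀ᶠ n in Filter.atTop, f n ≤ m := by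
  induction B with
  | zero =>
    refine ⟨0, Filter.Eventually.frequently ?_, hB⟩
    filter_upwards [hB] with n hn using Nat.le_zero.1 hn
  | succ B ih =>
    by_cases h : ∃ᶠ n in Filter.atTop, f n = B + 1
    · exact ⟨B + 1, h, hB⟩
    · refine ih ?_
      filter_upwards [hB, Filter.not_frequently.1 h] with n h1 h2
      omega

/-- A potential argument, for counters and for register contents: moves that strictly raise the
quantity stop eventually. -/
theorem eventually_const_of_mono_of_bounded (f : ℕ → ℕ) (B T : ℕ) (hB : ∀ n, f n ≤ B)
    (hmono : ∀ n, T ≤ n → f n ≤ f (n + 1)) : ∃ T', T ≤ T' ∧ ∀ n, T' ≤ n → f (n + 1) = f n := by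
  obtain ⟨m, hm, hle⟩ := exists_limsup_of_bounded f B (Filter.Eventually.of_forall hB)
  obtain ⟨T₁, hT₁⟩ := Filter.eventually_atTop.1 hle
  obtain ⟨T₂, h2, h2m⟩ := Filter.frequently_atTop.1 hm (max T T₁)
  have key : ∀ n, T₂ ≤ n → f n = m := by
    intro n hn
    induction n, hn using Nat.le_induction with
    | base => exact h2m
    | succ n hn ih =>
      have h3 := hmono n (by omega)
      have h4 := hT₁ (n + 1) (by omega)
      omega
  exact ⟨T₂, by omega, fun n hn => by rw [key n hn, key (n + 1) (by omega)]⟩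

/-- The greatest value of `f` on the `k`-th block of length `d`. -/
def blockSup (d : ℕ) (f : ℕ → ℕ) (k : ℕ) : ℕ := (Finset.range d).sup fun i => f (d * k + i)

/-- Games of different granularity are compared through blocks: 2 moves per tree level in the
acceptance game, 3 per step of the register game, 6 per tree level in the register game. -/
theorem parityAccepting_blockSup {d : ℕ} (hd : 0 < d) (f : ℕ → ℕ) :
    ParityAccepting (blockSup d f) ↔ ParityAccepting f := by
  have hle : ∀ n, f n ≤ blockSup d f (n / d) := by
    intro n
    have := Finset.le_sup (f := fun i => f (d * (n / d) + i))
      (Finset.mem_range.2 (Nat.mod_lt n hd))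
    simp only [Nat.div_add_mod] at this
    exact this
  have hex : ∀ k, ∃ i < d, f (d * k + i) = blockSup d f k := by
    intro k
    obtain ⟨i, hi, h⟩ := Finset.exists_mem_eq_sup (Finset.range d) ⟨0, Finset.mem_range.2 hd⟩
      fun i => f (d * k + i)
    exact ⟨i, Finset.mem_range.1 hi, h.symm⟩
  constructor
  · rintro ⟨m, hm, hfreq, hev⟩
    refine ⟨m, hm, ?_, ?_⟩
    · rw [Filter.frequently_atTop] at hfreq ⊢
      intro a
      obtain ⟨k, hk, hkm⟩ := hfreq a
      obtain ⟨i, -, hi⟩ := hex k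
      exact ⟨d * k + i, by nlinarith, hi.trans hkm⟩
    · rw [Filter.eventually_atTop] at hev ⊢
      obtain ⟨a, ha⟩ := hev
      exact ⟨a * d, fun n hn => (hle n).trans (ha _ ((Nat.le_div_iff_mul_le hd).2 hn))⟩
  · rintro ⟨m, hm, hfreq, hev⟩
    have hev' : ∀ᶠ k in Filter.atTop, blockSup d f k ≤ m := by
      rw [Filter.eventually_atTop] at hev ⊢
      obtain ⟨a, ha⟩ := hev
      exact ⟨a, fun k hk => Finset.sup_le fun i _ => ha _ (by nlinarith)⟩
    refine ⟨m, hm, ?_, hev'⟩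
    rw [Filter.eventually_atTop] at hev'
    obtain ⟨b, hb⟩ := hev'
    rw [Filter.frequently_atTop] at hfreq ⊢
    intro a
    obtain ⟨n, hn, hnm⟩ := hfreq ((max a b) * d)
    have h1 : max a b ≤ n / d := (Nat.le_div_iff_mul_le hd).2 hn
    refine ⟨n / d, by omega, le_antisymm (hb _ (by omega)) ?_⟩
    rw [← hnm]
    exact hle n

theorem parityAccepting_shift (f : ℕ → ℕ) (a : ℕ) :
    ParityAccepting (fun n => f (a + n)) ↔ ParityAccepting f := by
  have h1 : ∀ p : ℕ → Prop, (∀ᶠ n in Filter.atTop, p (a + n)) ↔ ∀ᶠ n in Filter.atTop, p n := by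
    intro p
    simp only [Filter.eventually_atTop]
    constructor
    · rintro ⟨b, hb⟩
      refine ⟨a + b, fun n hn => ?_⟩
      have := hb (n - a) (by omega)
      rwa [Nat.add_sub_cancel' (by omega)] at this
    · rintro ⟨b, hb⟩
      exact ⟨b, fun n hn => hb _ (by omega)⟩
  have h2 : ∀ p : ℕ → Prop, (∃ᶠ n in Filter.atTop, p (a + n)) ↔ ∃ᶠ n in Filter.atTop, p n :=
    fun p => not_congr (h1 fun n => ¬ p n)
  unfold ParityAccepting
  refine exists_congr fun m => and_congr_right fun _ => and_congr ?_ ?_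
  · exact h2 fun n => f n = m
  · exact h1 fun n => f n ≤ m

theorem parityAccepting_const (m : ℕ) : ParityAccepting (fun _ => m) ↔ Even m := by
  constructor
  · rintro ⟨m', hm', hfreq, -⟩
    obtain ⟨_, rfl⟩ := hfreq.exists
    exact hm'
  · intro h
    exact ⟨m, h, Filter.Frequently.of_forall fun _ => rfl,
      Filter.Eventually.of_forall fun _ => le_rfl⟩

/-! ### Sequences of register configurations -/

namespace RegConfig

variable {I J : Index} {n : ℕ}

theorem two_mul_le_output (c : RegConfig I J n) (j : J.Register) : 2 * j.1 ≤ c.output j := by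
  unfold output
  split_ifs <;> omega

theorem output_le (c : RegConfig I J n) (j : J.Register) : c.output j ≤ 2 * j.1 + 1 := by
  unfold output
  split_ifs <;> omega

theorem cntAfterOutput_of_ne (c : RegConfig I J n) {j m : J.Register} (k : I.Priority)
    (h : m ≠ j) : c.cntAfterOutput j k m = c.cnt k m := by
  unfold cntAfterOutput
  rw [if_neg]
  tauto

theorem update_reg_self (c : RegConfig I J n) (j : J.Register) (i : I.Priority) :
    (c.update j i).reg j = i := by
  simp [update]

theorem update_reg_of_lt (c : RegConfig I J n) {j m : J.Register} (i : I.Priority) (h : j < m) :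
    (c.update j i).reg m = max i (c.reg m) := by
  simp [update, h, h.ne']

theorem update_reg_of_gt (c : RegConfig I J n) {j m : J.Register} (i : I.Priority) (h : m < j) :
    (c.update j i).reg m = c.reg m := by
  simp [update, h.ne, h.not_gt]

theorem update_cnt_of_lt (c : RegConfig I J n) {j m : J.Register} (i k : I.Priority) (h : j < m) :
    (c.update j i).cnt k m = c.cnt k m := by
  simp [update, h.ne', h.not_gt, cntAfterOutput_of_ne]

theorem update_cnt_self_of_lt (c : RegConfig I J n) (j : J.Register) {i k : I.Priority}
    (h : k < i) : (c.update j i).cnt k j = 0 := by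
  simp [update, h]

theorem update_cnt_self_of_le (c : RegConfig I J n) (j : J.Register) {i k : I.Priority}
    (h : i ≤ k) : (c.update j i).cnt k j = c.cntAfterOutput j k j := by
  simp [update, h.not_gt]

theorem cntAfterOutput_of_reg_ne (c : RegConfig I J n) (j m : J.Register) {k : I.Priority}
    (h : c.reg j ≠ k) : c.cntAfterOutput j k m = c.cnt k m := by
  unfold cntAfterOutput
  rw [if_neg]
  exact fun h' => h h'.1.symm

theorem cntAfterOutput_reg (c : RegConfig I J n) (j : J.Register) (hj : J.lo ≤ 2 * j.1)
    (hodd : Odd (c.reg j).1) : c.cntAfterOutput j (c.reg j) j = c.cnt (c.reg j) j + 1 := by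
  simp [cntAfterOutput, hj, hodd]

/-- Once the register `m` has been chosen, it holds a priority recorded since, as long as no
greater register is chosen. -/
theorem exists_reg_eq (c : ℕ → RegConfig I J n) (j : ℕ → J.Register) (i : ℕ → I.Priority)
    (m : J.Register) {x y : ℕ} (hxy : x < y)
    (hc : ∀ z, z < y → c (z + 1) = (c z).update (j z) (i z)) (hx : j x = m)
    (hle : ∀ z, x ≤ z → z < y → j z ≤ m) : ∃ z, x ≤ z ∧ z < y ∧ (c y).reg m = i z := by
  induction y, Nat.succ_le_of_lt hxy using Nat.le_induction with
  | base => exact ⟨x, le_rfl, by omega, by rw [hc x (by omega), hx, update_reg_self]⟩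
  | succ y hy ih =>
    have hy' : x < y := hy
    rw [hc y (by omega)]
    rcases (hle y (by omega) (by omega)).lt_or_eq with h | h
    · rw [update_reg_of_lt _ _ h]
      rcases max_choice (i y) ((c y).reg m) with h' | h'
      · exact ⟨y, by omega, by omega, h'⟩
      · obtain ⟨z, h1, h2, h3⟩ := ih hy' (fun z hz => hc z (by omega))
          (fun z h1 h2 => hle z h1 (by omega))
        exact ⟨z, h1, by omega, h'.trans h3⟩
    · exact ⟨y, by omega, by omega, by rw [← h, update_reg_self]⟩

theorem even_of_recordable_even {l : ℕ} {i : I.Priority} (h : Recordable l i) (hi : Even i.1) :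
    i.1 = l := by
  unfold Recordable at h
  split_ifs at h with hl
  · exact h
  · exact absurd hi (Nat.not_even_iff_odd.2 h.1)

theorem le_of_recordable {l : ℕ} {i : I.Priority} (h : Recordable l i) : l ≤ i.1 := by
  unfold Recordable at h
  split_ifs at h with hl
  · exact h.ge
  · exact h.2

/-- Soundness of the registers: if the outputs are parity accepting, so are the labels. -/
theorem parityAccepting_of_output (c : ℕ → RegConfig I J n) (j : ℕ → J.Register)
    (i : ℕ → I.Priority) (a : ℕ → ℕ) (hrec : ∀ k, Recordable (a k) (i k))
    (hc : ∀ k, c (k + 1) = (c k).update (j k) (i k))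
    (hout : ParityAccepting fun k => (c k).output (j k)) : ParityAccepting a := by
  obtain ⟨p, hpf, hpe⟩ := exists_limsup_of_bounded (fun k => (i k).1) I.hi
    (Filter.Eventually.of_forall fun k => (i k).2.2)
  have hae : ∀ᶠ k in Filter.atTop, a k ≤ p := by
    filter_upwards [hpe] with k hk using (le_of_recordable (hrec k)).trans hk
  -- An even recorded priority is the label itself and no label exceeds what is recorded, so an even
  -- `p` is the limsup of the labels. The rest refutes an odd `p`.
  rcases Nat.even_or_odd p with hp | hp
  · refine ⟨p, hp, hpf.mono fun k hk => ?_, hae⟩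
    rw [← even_of_recordable_even (hrec k) (by rwa [hk]), hk]
  exfalso
  obtain ⟨m, hm, hmf, hme⟩ := hout
  obtain ⟨T, hT⟩ := Filter.eventually_atTop.1 (hpe.and hme)
  rw [Filter.frequently_atTop] at hpf hmf
  have hchosen : ∀ k, (c k).output (j k) = m → 2 * (j k).1 = m := by
    intro k hk
    have h1 := two_mul_le_output (c k) (j k)
    have h2 := output_le (c k) (j k)
    obtain ⟨m', rfl⟩ := hm
    omega
  obtain ⟨x, hxT, hx⟩ := hmf T
  simp only at hx
  have hjx := hchosen x hx
  set q := j x with hq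
  have hq_lo : J.lo ≤ 2 * q.1 := by
    by_contra h
    have : (c x).output q = 2 * q.1 + 1 := by simp [output, not_le.1 h]
    omega
  have hjle : ∀ k, T ≤ k → j k ≤ q := by
    intro k hk
    have h1 := two_mul_le_output (c k) (j k)
    have h2 : (c k).output (j k) ≤ m := (hT k hk).2
    exact Subtype.coe_le_coe.1 (by omega)
  have hpI : p ∈ Set.Icc I.lo I.hi := by
    obtain ⟨k, -, hk⟩ := hpf 0
    exact hk ▸ (i k).2
  let P : I.Priority := ⟨p, hpI⟩
  have hreg_le : ∀ y, x < y → (c y).reg q ≤ P := by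
    intro y hy
    obtain ⟨z, h1, h2, h3⟩ := exists_reg_eq c j i q hy (fun z _ => hc z) rfl
      (fun z h _ => hjle z (by omega))
    rw [h3]
    exact (hT z (by omega)).1
  have hstay : ∀ y, x < y → (c y).reg q = P → j y ≠ q → (c (y + 1)).reg q = P := by
    intro y hy h hne
    rw [hc, update_reg_of_lt _ _ ((hjle y (by omega)).lt_of_ne hne), h]
    exact max_eq_right (hT y (by omega)).1
  -- A full counter would produce `2q + 1`, which is above the limsup `m = 2q`.
  have hnofull : ∀ y, x < y → (c y).reg q = P → j y = q → ((c y).cnt P q : ℕ) ≠ n := by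
    intro y hy h hj hn
    have : (c y).output (j y) = 2 * q.1 + 1 := by
      rw [hj]
      unfold output
      rw [if_neg hq_lo.not_gt, h, if_neg (Nat.not_even_iff_odd.2 hp), if_pos hn]
    have h2 : (c y).output (j y) ≤ m := (hT y (by omega)).2
    omega
  have hinc : ∀ y, x < y → (c y).reg q = P → j y = q →
      ((c (y + 1)).cnt P q : ℕ) = (c y).cnt P q + 1 := by
    intro y hy h hj
    have hiy : i y ≤ P := (hT y (by omega)).1
    rw [hc, hj, update_cnt_self_of_le _ _ hiy]
    have h1 := cntAfterOutput_reg (c y) q hq_lo (by rw [h]; exact hp)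
    rw [h] at h1
    rw [h1, Fin.val_add_one_of_lt]
    rw [Fin.lt_def, Fin.val_last]
    have := hnofull y hy h hj
    have := ((c y).cnt P q).2
    omega
  -- A reset of `c_{P,q}` would need a recorded priority above `P` or a chosen register above `q`;
  -- both have stopped.
  have hmono : ∀ y, x + 1 ≤ y → ((c y).cnt P q : ℕ) ≤ (c (y + 1)).cnt P q := by
    intro y hy
    by_cases hj : j y = q
    · by_cases h : (c y).reg q = P
      · rw [hinc y (by omega) h hj]
        omega
      · rw [hc, hj, update_cnt_self_of_le _ _ (show i y ≤ P from (hT y (by omega)).1),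
          cntAfterOutput_of_reg_ne _ _ _ h]
    · rw [hc, update_cnt_of_lt _ _ _ ((hjle y (by omega)).lt_of_ne hj)]
  obtain ⟨T', hT', hconst⟩ := eventually_const_of_mono_of_bounded
    (fun y => ((c y).cnt P q : ℕ)) n (x + 1) (fun y => Nat.le_of_lt_succ ((c y).cnt P q).2) hmono
  -- After the counter has stabilised, recording `P` puts it into `r_q`, where it stays until `q` is
  -- chosen. That choice would increment the counter, so `q` is never chosen again, although `m`
  -- must still be output.
  obtain ⟨z, hz, hzp⟩ := hpf T'
  have hz' : i z = P := Subtype.ext hzp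
  have hregz : (c (z + 1)).reg q = P := by
    rcases (hjle z (by omega)).lt_or_eq with h | h
    · rw [hc, update_reg_of_lt _ _ h, hz']
      exact max_eq_left (hreg_le z (by omega))
    · rw [hc, h, update_reg_self, hz']
  have hno : ∀ y, z + 1 ≤ y → (c y).reg q = P ∧ j y ≠ q := by
    intro y hy
    have hne : ∀ y, z + 1 ≤ y → (c y).reg q = P → j y ≠ q := by
      intro y hy h hj
      have h1 := hinc y (by omega) h hj
      have h2 := hconst y (by omega)
      omega
    induction y, hy using Nat.le_induction with
    | base => exact ⟨hregz, hne _ le_rfl hregz⟩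
    | succ y hy ih =>
      have := hstay y (by omega) ih.1 ih.2
      exact ⟨this, hne _ (by omega) this⟩
  obtain ⟨w, hw, hwm⟩ := hmf (z + 1)
  refine (hno w hw).2 (Subtype.ext ?_)
  have := hchosen w hwm
  omega

end RegConfig
/-! ### Strategies in parity games -/

namespace ParityGame

variable {V : Type*} {I : Index}

theorem history_succ (p : ℕ → V) (n : ℕ) : history p (n + 1) = history p n ++ [p (n + 1)] := by
  simp [history, List.range_succ]

theorem getLast?_history (p : ℕ → V) (n : ℕ) : (history p n).getLast? = some (p n) := by
  simp [history, List.range_succ]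

/-- The first `n` moves of `p` form a play from the initial vertex in which Eve follows the
positional strategy `τ`. -/
def PositionallyConsistent (G : ParityGame V I) (τ : V → V) (p : ℕ → V) (n : ℕ) : Prop :=
  p 0 = G.init ∧ ∀ k < n, G.edge (p k) (p (k + 1)) ∧ (G.eve (p k) → p (k + 1) = τ (p k))

theorem eveWins_of_positional (G : ParityGame V I) (τ : V → V)
    (hlegal : ∀ p n, G.PositionallyConsistent τ p n → G.eve (p n) → G.edge (p n) (τ (p n)))
    (hwin : ∀ p, (∀ n, G.PositionallyConsistent τ p n) →
      ParityAccepting fun n => G.label (p n) (p (n + 1))) : G.EveWins := by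
  have key : ∀ p n, G.ConsistentUpTo (fun h => τ (h.getLast?.getD G.init)) p n ↔
      G.PositionallyConsistent τ p n := by
    intro p n
    simp only [ConsistentUpTo, PositionallyConsistent, getLast?_history, Option.getD_some]
  refine ⟨fun h => τ (h.getLast?.getD G.init), fun p n hp hv => ?_, fun p hp => ?_⟩
  · simp only [getLast?_history, Option.getD_some]
    exact hlegal p n ((key p n).1 hp) hv
  · exact hwin p fun n => (key p n).1 (hp n)

open Classical in
/-- The histories of the play in which Eve follows `σ` and Adam answers with `r`, using the bit
`β (idx n)` at time `n`. -/
noncomputable def replyHistory (G : ParityGame V I) (σ : List V → V) (r : V → Bool → V)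
    (idx : ℕ → ℕ) (β : ℕ → Bool) : ℕ → List V
  | 0 => [G.init]
  | n + 1 =>
    let h := replyHistory G σ r idx β n
    let v := h.getLast?.getD G.init
    h ++ [if G.eve v then σ h else r v (β (idx n))]

/-- A winning strategy yields a family of plays indexed by the choices of Adam. -/
theorem exists_plays (G : ParityGame V I) (hG : G.EveWins) (r : V → Bool → V)
    (hr : ∀ v b, ¬ G.eve v → G.edge v (r v b)) (idx : ℕ → ℕ) :
    ∃ p : (ℕ → Bool) → ℕ → V, (∀ β, p β 0 = G.init) ∧ (∀ β n, G.edge (p β n) (p β (n + 1))) ∧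
      (∀ β n, ¬ G.eve (p β n) → p β (n + 1) = r (p β n) (β (idx n))) ∧
      (∀ β, ParityAccepting fun n => G.label (p β n) (p β (n + 1))) ∧
      ∀ β β' n, (∀ m < n, ¬ G.eve (p β m) → β (idx m) = β' (idx m)) → p β n = p β' n := by
  classical
  obtain ⟨σ, hlegal, hwin⟩ := hG
  let H := G.replyHistory σ r idx
  let p : (ℕ → Bool) → ℕ → V := fun β n => (H β n).getLast?.getD G.init
  have hHs : ∀ β n, H β (n + 1) =
      H β n ++ [if G.eve (p β n) then σ (H β n) else r (p β n) (β (idx n))] := fun _ _ => rfl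
  have hps : ∀ β n, p β (n + 1) =
      if G.eve (p β n) then σ (H β n) else r (p β n) (β (idx n)) := by
    intro β n
    simp only [p]
    rw [hHs]
    simp [p]
  have hhist : ∀ β n, history (p β) n = H β n := by
    intro β n
    induction n with
    | zero => rfl
    | succ n ih => rw [history_succ, hHs, ih, hps]
  have hcons : ∀ β n, G.ConsistentUpTo σ (p β) n := by
    intro β n
    induction n with
    | zero => exact ⟨rfl, fun k hk => absurd hk (Nat.not_lt_zero k)⟩
    | succ n ih =>
      refine ⟨rfl, fun k hk => ?_⟩
      rcases Nat.lt_succ_iff_lt_or_eq.1 hk with hk | rfl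
      · exact ih.2 k hk
      · by_cases hv : G.eve (p β k)
        · have : p β (k + 1) = σ (history (p β) k) := by rw [hps, if_pos hv, hhist]
          exact ⟨this ▸ hlegal _ _ ih hv, fun _ => this⟩
        · refine ⟨?_, fun h => absurd h hv⟩
          rw [hps, if_neg hv]
          exact hr _ _ hv
  refine ⟨p, fun _ => rfl, fun β n => ((hcons β (n + 1)).2 n n.lt_succ_self).1,
    fun β n hv => by rw [hps, if_neg hv], fun β => hwin _ (hcons β), fun β β' n h => ?_⟩
  have : H β n = H β' n := by
    induction n with
    | zero => rfl
    | succ n ih =>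
      have h1 := ih fun m hm => h m (hm.trans n.lt_succ_self)
      have h2 : p β n = p β' n := by simp only [p, h1]
      rw [hHs, hHs, ← h2, ← h1]
      by_cases hv : G.eve (p β n)
      · simp only [if_pos hv]
      · simp only [if_neg hv, h n n.lt_succ_self hv]
  simp only [p, this]

end ParityGame

/-! ### Branches -/

namespace TreeAutomaton

theorem branchPrefix_zero (β : ℕ → Bool) : branchPrefix β 0 = [] := rfl

theorem branchPrefix_succ (β : ℕ → Bool) (n : ℕ) :
    branchPrefix β (n + 1) = branchPrefix β n ++ [β n] := by
  simp [branchPrefix, List.range_succ]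

theorem length_branchPrefix (β : ℕ → Bool) (n : ℕ) : (branchPrefix β n).length = n := by
  simp [branchPrefix]

theorem branchPrefix_congr {β β' : ℕ → Bool} {n : ℕ} (h : ∀ i < n, β i = β' i) :
    branchPrefix β n = branchPrefix β' n :=
  List.map_congr_left fun i hi => h i (List.mem_range.1 hi)

theorem eq_of_branchPrefix_eq {β β' : ℕ → Bool} {n : ℕ} (h : branchPrefix β n = branchPrefix β' n) :
    ∀ i < n, β i = β' i :=
  fun i hi => List.map_inj_left.1 h i (List.mem_range.2 hi)

/-- A branch through the node `w`. -/
def branchThrough (w : List Bool) (i : ℕ) : Bool := w.getD i false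

theorem branchPrefix_branchThrough (w : List Bool) :
    branchPrefix (branchThrough w) w.length = w := by
  refine List.ext_getElem (length_branchPrefix _ _) fun i h1 h2 => ?_
  simp [branchPrefix, branchThrough, h2]

theorem exists_branchPrefix_append (w : List Bool) (b : Bool) :
    ∃ β, branchPrefix β w.length = w ∧ β w.length = b := by
  have h := branchPrefix_branchThrough (w ++ [b])
  rw [List.length_append, List.length_singleton, branchPrefix_succ] at h
  obtain ⟨h1, h2⟩ := List.append_inj' h rfl
  exact ⟨_, h1, List.singleton_inj.1 h2⟩

/-- A causal function of branches defines a labelled tree. -/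
theorem exists_tree {T : Type*} (E : (ℕ → Bool) → ℕ → T)
    (hE : ∀ β β' n, (∀ i < n, β i = β' i) → E β n = E β' n) :
    ∃ ρ : LTree T, ∀ β n, ρ (branchPrefix β n) = E β n := by
  refine ⟨fun w => E (branchThrough w) w.length, fun β n => ?_⟩
  simp only [length_branchPrefix]
  refine hE _ _ _ (eq_of_branchPrefix_eq ?_)
  have := branchPrefix_branchThrough (branchPrefix β n)
  rwa [length_branchPrefix] at this

variable {α : Type*} {I : Index}

/-! ### Accepting runs versus winning strategies in the acceptance game -/

theorem gameLabel_adam (A : TreeAutomaton α I) (e : A.trans) (w : List Bool) (b : Bool)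
    (x : A.Q ⊕ A.trans) : A.gameLabel (w, .inr e) (w ++ [b], x) = A.prio e b := by
  cases b <;> simp [gameLabel]

theorem acceptanceGame_edge_left {A : TreeAutomaton α I} {t : LTree α} {w : List Bool} {q : A.Q}
    {v : List Bool × (A.Q ⊕ A.trans)} (h : (A.acceptanceGame t).edge (w, .inl q) v) :
    ∃ e, v = (w, .inr e) ∧ A.src e = q ∧ A.letter e = t w := by
  obtain ⟨w', q' | e⟩ := v
  · exact h.elim
  · obtain ⟨rfl, h⟩ := h
    exact ⟨e, rfl, h⟩

theorem acceptanceGame_edge_right {A : TreeAutomaton α I} {t : LTree α} {w : List Bool}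
    {e : A.trans} {v : List Bool × (A.Q ⊕ A.trans)}
    (h : (A.acceptanceGame t).edge (w, .inr e) v) :
    ∃ b, v = (w ++ [b], .inl (A.child e b)) := by
  obtain ⟨w', q' | e⟩ := v
  · obtain ⟨b, rfl, rfl⟩ := h
    exact ⟨b, rfl⟩
  · exact h.elim

/-- The answer of Adam that goes in direction `b`. -/
def adamReply (A : TreeAutomaton α I) :
    List Bool × (A.Q ⊕ A.trans) → Bool → List Bool × (A.Q ⊕ A.trans)
  | (w, .inr e), b => (w ++ [b], .inl (A.child e b))
  | v, _ => v

/-- Eve's positional strategy that follows the run `ρ`. -/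
def followRun (A : TreeAutomaton α I) (ρ : LTree A.trans) (v : List Bool × (A.Q ⊕ A.trans)) :
    List Bool × (A.Q ⊕ A.trans) :=
  (v.1, .inr (ρ v.1))

/-- The directions chosen by Adam in a play of the acceptance game. -/
def playBranch (A : TreeAutomaton α I) (p : ℕ → List Bool × (A.Q ⊕ A.trans)) (k : ℕ) : Bool :=
  decide ((p (2 * k + 2)).1 = (p (2 * k + 1)).1 ++ [true])

/-- Such a play is determined by Adam's directions: even times are at states, odd times at
transitions of `ρ`. -/
theorem play_of_followRun {A : TreeAutomaton α I} {t : LTree α} {ρ : LTree A.trans}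
    (hρ : A.IsRun t ρ) {p : ℕ → List Bool × (A.Q ⊕ A.trans)} {n : ℕ}
    (hp : (A.acceptanceGame t).PositionallyConsistent (A.followRun ρ) p n) (k : ℕ) :
    (2 * k ≤ n → p (2 * k) = (branchPrefix (A.playBranch p) k,
      .inl (A.src (ρ (branchPrefix (A.playBranch p) k))))) ∧
    (2 * k + 1 ≤ n → p (2 * k + 1) = (branchPrefix (A.playBranch p) k,
      .inr (ρ (branchPrefix (A.playBranch p) k)))) := by
  set β := A.playBranch p with hβ
  induction k with
  | zero =>
    have h0 : p 0 = ([], .inl A.init) := hp.1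
    refine ⟨fun _ => by rw [branchPrefix_zero, hρ.1]; exact h0, fun hn => ?_⟩
    have h := (hp.2 0 (by omega)).2 (by rw [h0]; rfl)
    rw [h0] at h
    exact h
  | succ k ih =>
    have hodd : 2 * (k + 1) ≤ n →
        p (2 * (k + 1)) = (branchPrefix β (k + 1), .inl (A.src (ρ (branchPrefix β (k + 1))))) := by
      intro hn
      have h1 := ih.2 (by omega)
      have h2 := (hp.2 (2 * k + 1) (by omega)).1
      rw [h1] at h2
      obtain ⟨b, hb⟩ := acceptanceGame_edge_right h2
      have hβ : β k = b := by
        rw [hβ, playBranch]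
        rw [show 2 * k + 2 = 2 * k + 1 + 1 from rfl, hb, h1]
        cases b <;> simp
      rw [branchPrefix_succ, hβ, hρ.2.2]
      exact hb
    refine ⟨hodd, fun hn => ?_⟩
    have h1 := hodd (by omega)
    have h := (hp.2 (2 * (k + 1)) (by omega)).2 (by rw [h1]; rfl)
    rw [h1] at h
    exact h

theorem edge_followRun {A : TreeAutomaton α I} {t : LTree α} {ρ : LTree A.trans}
    (hρ : A.IsRun t ρ) {p : ℕ → List Bool × (A.Q ⊕ A.trans)} {n : ℕ}
    (hp : (A.acceptanceGame t).PositionallyConsistent (A.followRun ρ) p n)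
    (hv : (A.acceptanceGame t).eve (p n)) :
    (A.acceptanceGame t).edge (p n) (A.followRun ρ (p n)) := by
  have hβ := play_of_followRun hρ hp
  rcases Nat.even_or_odd' n with ⟨k, rfl | rfl⟩
  · rw [(hβ k).1 le_rfl]
    exact ⟨rfl, rfl, hρ.2.1 _⟩
  · rw [(hβ k).2 le_rfl] at hv
    exact absurd hv (by simp [acceptanceGame])

theorem blockSup_gameLabel {A : TreeAutomaton α I} {ρ : LTree A.trans}
    {p : ℕ → List Bool × (A.Q ⊕ A.trans)} {β : ℕ → Bool} {k : ℕ} {q : A.Q} {x : A.Q ⊕ A.trans}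
    (h0 : p (2 * k) = (branchPrefix β k, .inl q))
    (h1 : p (2 * k + 1) = (branchPrefix β k, .inr (ρ (branchPrefix β k))))
    (h2 : p (2 * k + 2) = (branchPrefix β (k + 1), x)) :
    blockSup 2 (fun n => A.gameLabel (p n) (p (n + 1))) k =
      A.prio (ρ (branchPrefix β k)) (β k) := by
  have : blockSup 2 (fun n => A.gameLabel (p n) (p (n + 1))) k =
      max (A.gameLabel (p (2 * k)) (p (2 * k + 1)))
        (A.gameLabel (p (2 * k + 1)) (p (2 * k + 2))) := by
    simp [blockSup, Finset.range_add_one, max_comm]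
  rw [this, h0, h1, h2, branchPrefix_succ, gameLabel_adam]
  exact max_eq_right (A.prio _ _).2.1

theorem mem_language_of_isAcceptingRun {A : TreeAutomaton α I} {t : LTree α} {ρ : LTree A.trans}
    (hρ : A.IsAcceptingRun t ρ) : t ∈ A.language := by
  refine (A.acceptanceGame t).eveWins_of_positional (A.followRun ρ)
    (fun p n hp hv => edge_followRun hρ.1 hp hv) fun p hp => ?_
  have hβ := fun k => play_of_followRun hρ.1 (hp (2 * k + 2)) k
  rw [← parityAccepting_blockSup two_pos]
  have h := hρ.2 (A.playBranch p)
  convert h using 2 with k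
  exact blockSup_gameLabel ((hβ k).1 (by omega)) ((hβ k).2 (by omega)) ((hβ (k + 1)).1 (by omega))

/-- To be an accepting run can be checked along the branches. -/
theorem isAcceptingRun_of_branches {A : TreeAutomaton α I} {t : LTree α} {ρ : LTree A.trans}
    (hinit : A.src (ρ []) = A.init)
    (hletter : ∀ β k, A.letter (ρ (branchPrefix β k)) = t (branchPrefix β k))
    (hchild : ∀ β k, A.src (ρ (branchPrefix β (k + 1))) = A.child (ρ (branchPrefix β k)) (β k))
    (hacc : ∀ β, ParityAccepting fun n => (A.prio (ρ (branchPrefix β n)) (β n) : ℕ)) :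
    A.IsAcceptingRun t ρ := by
  refine ⟨⟨hinit, fun w => ?_, fun w b => ?_⟩, hacc⟩
  · have := hletter (branchThrough w) w.length
    rwa [branchPrefix_branchThrough] at this
  · obtain ⟨β, h1, h2⟩ := exists_branchPrefix_append w b
    have := hchild β w.length
    rwa [branchPrefix_succ, h1, h2] at this

/-- The strategy may depend on the history, so it is played against all branches at once. The
transition chosen at a node depends only on the directions leading there, so these plays glue into a
tree. -/
theorem exists_isAcceptingRun_of_mem_language {A : TreeAutomaton α I} {t : LTree α}
    (ht : t ∈ A.language) : ∃ ρ, A.IsAcceptingRun t ρ := by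
  obtain ⟨p, hp0, hedge, hadam, hacc, hcausal⟩ := (A.acceptanceGame t).exists_plays ht A.adamReply
    (by
      rintro ⟨w, q | e⟩ b hv
      · exact absurd rfl hv
      · exact ⟨b, rfl, rfl⟩) fun n => n / 2
  have hstep : ∀ β k q, p β (2 * k) = (branchPrefix β k, .inl q) →
      ∃ e, p β (2 * k + 1) = (branchPrefix β k, .inr e) ∧ A.src e = q ∧
        A.letter e = t (branchPrefix β k) ∧
        p β (2 * (k + 1)) = (branchPrefix β (k + 1), .inl (A.child e (β k))) := by
    intro β k q hq
    have h1 := hedge β (2 * k)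
    rw [hq] at h1
    obtain ⟨e, he, h2, h3⟩ := acceptanceGame_edge_left h1
    refine ⟨e, he, h2, h3, ?_⟩
    have h4 := hadam β (2 * k + 1) (by rw [he]; simp [acceptanceGame])
    rw [he, show (2 * k + 1) / 2 = k by omega] at h4
    rw [branchPrefix_succ]
    exact h4
  have hpos : ∀ β k, ∃ q, p β (2 * k) = (branchPrefix β k, .inl q) := by
    intro β k
    induction k with
    | zero => exact ⟨A.init, hp0 β⟩
    | succ k ih =>
      obtain ⟨q, hq⟩ := ih
      obtain ⟨e, -, -, -, h⟩ := hstep β k q hq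
      exact ⟨_, h⟩
  choose q hq using hpos
  choose E hE1 hE2 hE3 hE4 using fun β k => hstep β k _ (hq β k)
  obtain ⟨ρ, hρ⟩ := exists_tree E (by
    intro β β' n h
    have h1 : p β (2 * n + 1) = p β' (2 * n + 1) := by
      refine hcausal _ _ _ fun m hm hv => ?_
      rcases Nat.even_or_odd' m with ⟨i, rfl | rfl⟩
      · rw [hq] at hv
        exact absurd rfl hv
      · exact h _ (by omega)
    rw [hE1, hE1] at h1
    exact Sum.inr_injective (Prod.ext_iff.1 h1).2)
  refine ⟨ρ, isAcceptingRun_of_branches ?_ (fun β k => ?_) (fun β k => ?_) fun β => ?_⟩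
  · have h1 := hρ (fun _ => false) 0
    rw [branchPrefix_zero] at h1
    rw [h1, hE2]
    have h2 := (hq (fun _ => false) 0).symm.trans (hp0 _)
    exact Sum.inl_injective (Prod.ext_iff.1 h2).2
  · rw [hρ, hE3]
  · rw [hρ, hρ, hE2]
    have h2 := (hq β (k + 1)).symm.trans (hE4 β k)
    exact Sum.inl_injective (Prod.ext_iff.1 h2).2
  · have h := hacc β
    rw [← parityAccepting_blockSup two_pos] at h
    convert h using 2 with k
    refine (blockSup_gameLabel (hq β k) ?_ (hq β (k + 1))).symm
    rw [hE1, hρ]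

theorem mem_language_iff {A : TreeAutomaton α I} {t : LTree α} :
    t ∈ A.language ↔ ∃ ρ, A.IsAcceptingRun t ρ :=
  ⟨exists_isAcceptingRun_of_mem_language, fun ⟨_, h⟩ => mem_language_of_isAcceptingRun h⟩

end TreeAutomaton
/-! ### The automaton that simulates the priority transduction game -/

/-- The sequence `f 0, g 0, f 1, g 1, …`. -/
def interleave {T : Type*} (f g : ℕ → T) (m : ℕ) : T := if m % 2 = 0 then f (m / 2) else g (m / 2)

theorem interleave_even {T : Type*} (f g : ℕ → T) (k : ℕ) : interleave f g (2 * k) = f k := by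
  simp [interleave]

theorem interleave_odd {T : Type*} (f g : ℕ → T) (k : ℕ) : interleave f g (2 * k + 1) = g k := by
  simp [interleave, Nat.add_mod, show (2 * k + 1) / 2 = k by omega]

theorem blockSup_interleave (f g : ℕ → ℕ) (k : ℕ) :
    blockSup 2 (interleave f g) k = max (f k) (g k) := by
  simp [blockSup, Finset.range_add_one, interleave_even, interleave_odd, max_comm]

/-- One step of the priority transduction game: from the configuration `c`, an edge of label `a`
may lead to the configuration `c'` with output `o`. -/
def RegConfig.Step {I J : Index} {n : ℕ} (c : RegConfig I J n) (a : ℕ) (c' : RegConfig I J n)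
    (o : ℕ) : Prop :=
  ∃ j i, Recordable a i ∧ c.output j = o ∧ o ∈ Set.Icc J.lo J.hi ∧ c' = c.update j i

instance (J : Index) : Finite J.Register :=
  Set.Finite.to_subtype ((Set.finite_Iic (J.lo + J.hi)).subset fun j hj => by
    have hj' : (J.lo ≤ 2 * j ∧ 2 * j ≤ J.hi) ∨ 2 * j + 1 = J.lo := hj
    show j ≤ J.lo + J.hi
    omega)

instance (I J : Index) (n : ℕ) : Finite (RegConfig I J n) :=
  Finite.of_injective (fun c => (c.reg, c.cnt)) fun c c' h => by
    cases c
    cases c'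
    simp only [Prod.mk.injEq] at h
    rw [h.1, h.2]

theorem ParityGame.Reg_three_moves {V : Type*} {I J : Index} {n : ℕ} {G : ParityGame V I}
    {u : V} {c : RegConfig I J n} {x₁ x₂ x₃ : RegPos V I J n}
    (h₁ : (Reg J n G).edge (.vertex u c) x₁) (h₂ : (Reg J n G).edge x₁ x₂)
    (h₃ : (Reg J n G).edge x₂ x₃) :
    ∃ v j c' o, x₁ = .taken u v c ∧ G.edge u v ∧ x₂ = .chosen u v c j ∧ x₃ = .vertex v c' ∧
      c.Step (G.label u v) c' o ∧ (Reg J n G).label x₂ x₃ = o := by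
  cases x₁ with
  | vertex => exact h₁.elim
  | chosen => exact h₁.elim
  | taken u' v c₁ =>
    obtain ⟨rfl, rfl, huv⟩ := h₁
    cases x₂ with
    | vertex => exact h₂.elim
    | taken => exact h₂.elim
    | chosen u₂ v₂ c₂ j =>
      obtain ⟨rfl, rfl, rfl⟩ := h₂
      cases x₃ with
      | taken => exact h₃.elim
      | chosen => exact h₃.elim
      | vertex v₃ c₃ =>
        obtain ⟨rfl, hout, i, hi, rfl⟩ := h₃
        exact ⟨_, _, _, _, rfl, huv, rfl, rfl, ⟨j, i, hi, rfl, hout, rfl⟩, rfl⟩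

namespace TreeAutomaton

variable {α : Type*} {I : Index}

/-- The automaton that guesses a run of `A` together with choices of Eve in the priority
transduction game. Its states remember the last output. -/
def regAutomaton (A : TreeAutomaton α I) (J : Index) (n : ℕ) : TreeAutomaton α J where
  -- A transition is only a tuple of states and a letter, so its priorities must be readable from
  -- its target states.
  Q := A.Q × RegConfig I J n × J.Priority
  finite_Q := by
    have := A.finite_Q
    infer_instance
  init := (A.init, RegConfig.initial I J n, ⟨J.lo, le_rfl, J.lo_le_hi⟩)
  -- One tree level is two steps of the register game, the first with the label `I.lo` of Eve's
  -- move. The intermediate configuration may differ in the two directions; this is harmless,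
  -- because soundness is applied to each branch separately.
  trans := {e | ∃ h : (e.1.1, e.2.1, e.2.2.1.1, e.2.2.2.1) ∈ A.trans, ∀ b : Bool,
    ∃ c' o₁ o₂, e.1.2.1.Step I.lo c' o₁ ∧
      c'.Step (A.prio ⟨_, h⟩ b) (if b then e.2.2.2 else e.2.2.1).2.1 o₂ ∧
      (if b then e.2.2.2 else e.2.2.1).2.2.1 = max o₁ o₂}
  prio e b := (if b then e.1.2.2.2 else e.1.2.2.1).2.2

theorem mem_regAutomaton_trans (A : TreeAutomaton α I) {J : Index} {n : ℕ}
    {s : (A.regAutomaton J n).Q} {a : α} {s' : Bool → (A.regAutomaton J n).Q} (e : A.trans)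
    (hsrc : A.src e = s.1) (hletter : A.letter e = a) (hchild : ∀ b, A.child e b = (s' b).1)
    (hstep : ∀ b, ∃ c' o₁ o₂, s.2.1.Step I.lo c' o₁ ∧ c'.Step (A.prio e b) (s' b).2.1 o₂ ∧
      (s' b).2.2.1 = max o₁ o₂) :
    (s, a, s' false, s' true) ∈ (A.regAutomaton J n).trans := by
  obtain ⟨⟨q, a', q₀, q₁⟩, he⟩ := e
  have h0 := hchild false
  have h1 := hchild true
  simp only [src, letter, child] at hsrc hletter h0 h1
  simp only [Bool.false_eq_true, if_false, if_true] at h0 h1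
  subst hsrc hletter h0 h1
  refine ⟨he, fun b => ?_⟩
  have := hstep b
  cases b <;> exact this

/-- The transition of `A` that underlies a transition of the simulating automaton. -/
def regProj (A : TreeAutomaton α I) {J : Index} {n : ℕ} (e : (A.regAutomaton J n).trans) :
    A.trans :=
  ⟨_, e.2.choose⟩

/-- Along a branch the steps witnessed by consecutive transitions fit into one sequence of
configurations, to which the soundness of the registers applies. -/
theorem isAcceptingRun_regProj (A : TreeAutomaton α I) {J : Index} {n : ℕ} {t : LTree α}
    {ρ : LTree (A.regAutomaton J n).trans} (hρ : (A.regAutomaton J n).IsAcceptingRun t ρ) :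
    A.IsAcceptingRun t fun w => A.regProj (ρ w) := by
  obtain ⟨⟨hinit, hletter, hchild⟩, hacc⟩ := hρ
  refine ⟨⟨?_, fun w => hletter w, fun w b => ?_⟩, fun β => ?_⟩
  · exact (Prod.ext_iff.1 hinit).1
  · have := (Prod.ext_iff.1 (hchild w b)).1
    refine this.trans ?_
    cases b <;> rfl
  let e : ℕ → (A.regAutomaton J n).trans := fun k => ρ (branchPrefix β k)
  have hex : ∀ k, ∃ c' o₁ o₂, (e k).1.1.2.1.Step I.lo c' o₁ ∧
      c'.Step (A.prio (A.regProj (e k)) (β k)) (e (k + 1)).1.1.2.1 o₂ ∧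
      ((A.regAutomaton J n).prio (e k) (β k)).1 = max o₁ o₂ := by
    intro k
    obtain ⟨c', o₁, o₂, h1, h2, h3⟩ := (e k).2.choose_spec (β k)
    refine ⟨c', o₁, o₂, h1, ?_, h3⟩
    have : (e (k + 1)).1.1 = if β k then (e k).1.2.2.2 else (e k).1.2.2.1 := by
      have := hchild (branchPrefix β k) (β k)
      rw [← branchPrefix_succ] at this
      exact this
    rw [this]
    exact h2
  choose c' o₁ o₂ h1 h2 h3 using hex
  let a : ℕ → ℕ := interleave (fun _ => I.lo) fun k => A.prio (A.regProj (e k)) (β k)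
  let C : ℕ → RegConfig I J n := interleave (fun k => (e k).1.1.2.1) c'
  have hC : ∀ m, ∃ j i, Recordable (a m) i ∧ (C m).output j = interleave o₁ o₂ m ∧
      C (m + 1) = (C m).update j i := by
    intro m
    rcases Nat.even_or_odd' m with ⟨k, rfl | rfl⟩
    · simp only [a, C, interleave_even, interleave_odd]
      obtain ⟨j, i, hr, ho, -, hu⟩ := h1 k
      exact ⟨j, i, hr, ho, hu⟩
    · simp only [a, C, interleave_odd, show 2 * k + 1 + 1 = 2 * (k + 1) by ring, interleave_even]
      obtain ⟨j, i, hr, ho, -, hu⟩ := h2 k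
      exact ⟨j, i, hr, ho, hu⟩
  choose j i hr ho hu using hC
  have hout : ParityAccepting fun m => (C m).output (j m) := by
    rw [funext ho, ← parityAccepting_blockSup two_pos]
    have h := hacc β
    convert h using 2 with k
    rw [blockSup_interleave]
    exact (h3 k).symm
  have h := RegConfig.parityAccepting_of_output C j i a hr hu hout
  rw [← parityAccepting_blockSup two_pos] at h
  convert h using 2 with k
  rw [blockSup_interleave]
  exact (max_eq_right (A.prio _ _).2.1).symm

theorem regAutomaton_language_subset (A : TreeAutomaton α I) (J : Index) (n : ℕ) :
    (A.regAutomaton J n).language ⊆ A.language := by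
  intro t ht
  obtain ⟨ρ, hρ⟩ := exists_isAcceptingRun_of_mem_language ht
  exact mem_language_of_isAcceptingRun (A.isAcceptingRun_regProj hρ)

/-- The answer of Adam in direction `b` in the priority transduction game. -/
def regAdamReply (A : TreeAutomaton α I) {J : Index} {n : ℕ} :
    RegPos (List Bool × (A.Q ⊕ A.trans)) I J n → Bool → RegPos (List Bool × (A.Q ⊕ A.trans)) I J n
  | .vertex u c, b => .taken u (A.adamReply u b) c
  | v, _ => v

/-- As for the acceptance game, the plays of a winning strategy against all branches glue into a
run; what is glued here is a tree of states, from which the transitions are read off. -/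
theorem mem_regAutomaton_language (A : TreeAutomaton α I) {J : Index} {n : ℕ} {t : LTree α}
    (h : (Reg J n (A.acceptanceGame t)).EveWins) : t ∈ (A.regAutomaton J n).language := by
  obtain ⟨p, hp0, hedge, hadam, hacc, hcausal⟩ := (Reg J n (A.acceptanceGame t)).exists_plays h
    A.regAdamReply
    (by
      rintro (⟨⟨w, q | e⟩, c⟩ | _ | _) b hv
      · exact absurd rfl hv
      · exact ⟨rfl, rfl, b, rfl, rfl⟩
      · exact absurd trivial hv
      · exact absurd trivial hv) fun n => n / 6
  let O : (ℕ → Bool) → ℕ → ℕ := fun β =>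
    blockSup 6 fun m => (Reg J n (A.acceptanceGame t)).label (p β m) (p β (m + 1))
  have hO : ∀ β k, O β k ∈ Set.Icc J.lo J.hi := by
    intro β k
    refine ⟨?_, Finset.sup_le fun i _ => (ParityGame.label_mem _ _ _ (hedge β _)).2⟩
    exact (ParityGame.label_mem _ _ _ (hedge β (6 * k + 0))).1.trans
      (Finset.le_sup (f := fun i => (Reg J n (A.acceptanceGame t)).label (p β (6 * k + i))
        (p β (6 * k + i + 1))) (Finset.mem_range.2 (by norm_num)))
  have hstep : ∀ β k q c, p β (6 * k) = .vertex (branchPrefix β k, .inl q) c →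
      ∃ e c' c'' o₁ o₂, (∀ i < 3, (Reg J n (A.acceptanceGame t)).eve (p β (6 * k + i))) ∧
        p β (6 * k + 3) = .vertex (branchPrefix β k, .inr e) c' ∧ A.src e = q ∧
        A.letter e = t (branchPrefix β k) ∧ c.Step I.lo c' o₁ ∧
        p β (6 * (k + 1)) = .vertex (branchPrefix β (k + 1), .inl (A.child e (β k))) c'' ∧
        c'.Step (A.prio e (β k)) c'' o₂ ∧ O β k = max o₁ o₂ := by
    intro β k q c hq
    have e0 := hedge β (6 * k)
    rw [hq] at e0
    obtain ⟨v, j, c', o₁, p1, huv, p2, p3, hs, hl⟩ :=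
      ParityGame.Reg_three_moves e0 (hedge β (6 * k + 1)) (hedge β (6 * k + 2))
    obtain ⟨e, rfl, hsrc, hlet⟩ := acceptanceGame_edge_left huv
    have e3 := hedge β (6 * k + 3)
    have a3 := hadam β (6 * k + 3)
    rw [p3] at e3 a3
    obtain ⟨v', j', c'', o₂, p4, huv', p5, p6, hs', hl'⟩ :=
      ParityGame.Reg_three_moves e3 (hedge β (6 * k + 4)) (hedge β (6 * k + 5))
    have hv' := p4.symm.trans (a3 (by simp [Reg, RegPos.eve, acceptanceGame]))
    rw [show (6 * k + 3) / 6 = k by omega] at hv'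
    simp only [regAdamReply, RegPos.taken.injEq, true_and, and_true] at hv'
    subst hv'
    refine ⟨e, c', c'', o₁, o₂, ?_, p3, hsrc, hlet, hs, ?_, ?_, ?_⟩
    · intro i hi
      interval_cases i
      · rw [Nat.add_zero, hq]
        rfl
      · rw [p1]
        trivial
      · rw [p2]
        trivial
    · rw [branchPrefix_succ]
      exact p6
    · have : (A.acceptanceGame t).label (branchPrefix β k, .inr e)
          (A.adamReply (branchPrefix β k, .inr e) (β k)) = A.prio e (β k) :=
        A.gameLabel_adam _ _ _ (.inl (A.child e (β k)))
      rwa [this] at hs'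
    · have l0 : (Reg J n (A.acceptanceGame t)).label (p β (6 * k)) (p β (6 * k + 1)) = J.lo := by
        rw [hq]; rfl
      have l1 : (Reg J n (A.acceptanceGame t)).label (p β (6 * k + 1)) (p β (6 * k + 2)) =
          J.lo := by
        rw [p1]; rfl
      have l3 : (Reg J n (A.acceptanceGame t)).label (p β (6 * k + 3)) (p β (6 * k + 4)) =
          J.lo := by
        rw [p3]; rfl
      have l4 : (Reg J n (A.acceptanceGame t)).label (p β (6 * k + 4)) (p β (6 * k + 5)) =
          J.lo := by
        rw [p4]; rfl
      have h1 : J.lo ≤ o₁ := by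
        obtain ⟨_, _, _, _, h, _⟩ := hs
        exact h.1
      simp only [O, blockSup, Finset.range_add_one, Finset.range_zero, Finset.sup_insert,
        Finset.sup_empty, Nat.add_zero, Nat.add_assoc, Nat.reduceAdd, l0, l1, l3, l4]
      rw [show (Reg J n (A.acceptanceGame t)).label (p β (6 * k + 2)) (p β (6 * k + 3)) =
          o₁ from hl,
        show (Reg J n (A.acceptanceGame t)).label (p β (6 * k + 5)) (p β (6 * k + 6)) = o₂ from hl']
      simp only [Nat.bot_eq_zero]
      omega
  have hpos : ∀ β k, ∃ q c, p β (6 * k) = .vertex (branchPrefix β k, .inl q) c := by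
    intro β k
    induction k with
    | zero => exact ⟨_, _, hp0 β⟩
    | succ k ih =>
      obtain ⟨q, c, hq⟩ := ih
      obtain ⟨e, c', c'', o₁, o₂, -, -, -, -, -, h, -⟩ := hstep β k q c hq
      exact ⟨_, _, h⟩
  choose q c hq using hpos
  choose E c' c'' o₁ o₂ hE1 hE2 hE3 hE4 hE5 hE6 hE7 hE8 using fun β k => hstep β k _ _ (hq β k)
  have hqs : ∀ β k, q β (k + 1) = A.child (E β k) (β k) ∧ c β (k + 1) = c'' β k := by
    intro β k
    have := (hq β (k + 1)).symm.trans (hE6 β k)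
    simpa using this
  have hcaus : ∀ β β' k, (∀ i < k, β i = β' i) → ∀ m ≤ 6 * k, p β m = p β' m :=
    fun β β' k h m hm => hcausal _ _ _ fun m' hm' _ => h _ (by omega)
  -- The first three moves of a level belong to Eve, so the transition and the intermediate
  -- configuration do not depend on the direction taken next.
  have hcaus3 : ∀ β β' k, (∀ i < k, β i = β' i) → E β k = E β' k ∧ c' β k = c' β' k := by
    intro β β' k h
    have h1 : p β (6 * k + 3) = p β' (6 * k + 3) := by
      refine hcausal _ _ _ fun m hm hv => h _ ?_
      by_contra hmk
      obtain ⟨i, rfl⟩ := Nat.exists_eq_add_of_le (show 6 * k ≤ m by omega)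
      exact hv (hE1 β k i (by omega))
    rw [hE2, hE2] at h1
    simpa [branchPrefix_congr h] using h1
  -- A state stores the output of the level above it; the root, having none, gets the initial value
  -- `J.lo`.
  let O' : (ℕ → Bool) → ℕ → J.Priority := fun β k =>
    match k with
    | 0 => ⟨J.lo, le_rfl, J.lo_le_hi⟩
    | k + 1 => ⟨O β k, hO β k⟩
  obtain ⟨S, hS⟩ := exists_tree
    (fun β k => ((q β k, c β k, O' β k) : (A.regAutomaton J n).Q)) (by
      intro β β' k h
      have h1 := hcaus β β' k h (6 * k) le_rfl
      rw [hq, hq] at h1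
      have h2 : q β k = q β' k ∧ c β k = c β' k := by
        simpa [branchPrefix_congr h] using h1
      have h3 : O' β k = O' β' k := by
        cases k with
        | zero => rfl
        | succ k =>
          refine Subtype.ext (show O β k = O β' k from Finset.sup_congr rfl fun i hi => ?_)
          have := Finset.mem_range.1 hi
          simp only [hcaus β β' _ h (6 * k + i) (by omega),
            hcaus β β' _ h (6 * k + i + 1) (by omega)]
      simp only [h2.1, h2.2, h3])
  have hmem : ∀ w, (S w, t w, S (w ++ [false]), S (w ++ [true])) ∈ (A.regAutomaton J n).trans := by
    intro w
    have hw : ∀ b, ∃ β, branchPrefix β w.length = w ∧ β w.length = b :=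
      exists_branchPrefix_append w
    obtain ⟨β, hβ, -⟩ := hw false
    have hSw : ∀ β, branchPrefix β w.length = w →
        S w = (q β w.length, c β w.length, O' β w.length) := by
      intro β hβ
      have := hS β w.length
      rwa [hβ] at this
    have hSb : ∀ β, branchPrefix β w.length = w → S (w ++ [β w.length]) =
        (A.child (E β w.length) (β w.length), c'' β w.length, ⟨O β w.length, hO β w.length⟩) := by
      intro β hβ
      have := hS β (w.length + 1)
      rwa [branchPrefix_succ, hβ, (hqs β _).1, (hqs β _).2] at this
    refine A.mem_regAutomaton_trans (s' := fun b => S (w ++ [b])) (E β w.length) ?_ ?_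
      (fun b => ?_) (fun b => ?_)
    · rw [hE3, hSw β hβ]
    · rw [hE4, hβ]
    all_goals
      obtain ⟨γ, hγ, hb⟩ := hw b
      have h1 := hSb γ hγ
      have h2 := hcaus3 β γ w.length (eq_of_branchPrefix_eq (hβ.trans hγ.symm))
      rw [hb] at h1
    · simp only [h1, h2.1]
    · refine ⟨c' γ w.length, o₁ γ w.length, o₂ γ w.length, ?_, ?_, ?_⟩
      · rw [hSw γ hγ]
        exact hE5 γ _
      · rw [h1, h2.1]
        have := hE7 γ w.length
        rwa [hb] at this
      · simp only [h1, hE8]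
  refine mem_language_of_isAcceptingRun (ρ := fun w => ⟨_, hmem w⟩)
    ⟨⟨?_, fun w => rfl, fun w b => ?_⟩, fun β => ?_⟩
  · have h1 := hS (fun _ => false) 0
    have h2 := (hq (fun _ => false) 0).symm.trans (hp0 _)
    simp only [Reg, acceptanceGame, RegPos.vertex.injEq, Prod.mk.injEq, Sum.inl.injEq] at h2
    refine h1.trans ?_
    simp only [h2, O']
    rfl
  · cases b <;> rfl
  · have h := hacc β
    rw [← parityAccepting_blockSup (by norm_num : 0 < 6)] at h
    convert h using 2 with k
    have h1 := hS β (k + 1)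
    rw [branchPrefix_succ] at h1
    have h2 : ((A.regAutomaton J n).prio ⟨_, hmem (branchPrefix β k)⟩ (β k)) =
        (S (branchPrefix β k ++ [β k])).2.2 := by
      cases β k <;> rfl
    rw [h2, h1]

end TreeAutomaton
/-! ### Eve's choice of registers -/

/-- The register that corresponds to the priority `b`. -/
def Index.registerOf (J : Index) (b : J.Priority) : J.Register :=
  ⟨b.1 / 2, by
    have h := b.2
    simp only [Set.mem_Icc] at h ⊢
    omega⟩

namespace RegConfig

variable {I J : Index} {n : ℕ}

/-- The rule behind Eve's strategy. Moving a large even label to the greatest register that holds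
less strictly raises that register, so such detours above a fixed level cannot go on for ever, and
they reset the counters of smaller odd priorities there. -/
theorem exists_choice (c : RegConfig I J n) (j₀ : J.Register) (a : I.Priority) :
    ∃ j, (j = j₀ ∧ (Even a.1 → ∀ j', j₀ < j' → a ≤ c.reg j')) ∨
      (j₀ < j ∧ Even a.1 ∧ c.reg j < a ∧ ∀ j', j < j' → a ≤ c.reg j') := by
  by_cases h : Even a.1 ∧ ∃ j', j₀ < j' ∧ c.reg j' < a
  · obtain ⟨ha, hne⟩ := h
    obtain ⟨j, ⟨h1, h2⟩, hmax⟩ := (Set.toFinite {j' | j₀ < j' ∧ c.reg j' < a}).exists_maximal hne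
    refine ⟨j, Or.inr ⟨h1, ha, h2, fun j' hj' => ?_⟩⟩
    by_contra hlt
    exact hj'.not_ge (hmax ⟨h1.trans hj', not_le.1 hlt⟩ hj'.le)
  · refine ⟨j₀, Or.inl ⟨rfl, fun ha j' hj' => ?_⟩⟩
    by_contra hlt
    exact h ⟨ha, j', hj', not_le.1 hlt⟩

/-- When `a` is even and some register above `j₀` holds less than `a`, the greatest such register;
otherwise `j₀`. -/
noncomputable def choice (c : RegConfig I J n) (j₀ : J.Register) (a : I.Priority) : J.Register :=
  (c.exists_choice j₀ a).choose

theorem choice_spec (c : RegConfig I J n) (j₀ : J.Register) (a : I.Priority) :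
    (c.choice j₀ a = j₀ ∧ (Even a.1 → ∀ j', j₀ < j' → a ≤ c.reg j')) ∨
      (j₀ < c.choice j₀ a ∧ Even a.1 ∧ c.reg (c.choice j₀ a) < a ∧
        ∀ j', c.choice j₀ a < j' → a ≤ c.reg j') :=
  (c.exists_choice j₀ a).choose_spec

theorem le_choice (c : RegConfig I J n) (j₀ : J.Register) (a : I.Priority) :
    j₀ ≤ c.choice j₀ a := by
  rcases c.choice_spec j₀ a with h | h
  · exact h.1.ge
  · exact h.1.le

theorem le_choice_of_reg_lt (c : RegConfig I J n) {j₀ q : J.Register} {a : I.Priority}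
    (hq : j₀ ≤ q) (ha : Even a.1) (h : c.reg q < a) : q ≤ c.choice j₀ a := by
  rcases c.choice_spec j₀ a with h' | h'
  · rcases hq.lt_or_eq with h1 | h1
    · exact absurd (h'.2 ha q h1) h.not_ge
    · exact h1 ▸ h'.1.ge
  · by_contra hlt
    exact absurd (h'.2.2.2 q (not_le.1 hlt)) h.not_ge

/-- The configurations obtained when the labels are `a` and the registers are chosen according to
the priorities `b`. -/
noncomputable def follow (n : ℕ) (a : ℕ → I.Priority) (b : ℕ → J.Priority) : ℕ → RegConfig I J n
  | 0 => initial I J n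
  | k + 1 =>
    (follow n a b k).update ((follow n a b k).choice (J.registerOf (b k)) (a k)) (a k)

/-- The registers chosen along `follow`. -/
noncomputable def followChoice (n : ℕ) (a : ℕ → I.Priority) (b : ℕ → J.Priority) (k : ℕ) :
    J.Register :=
  (follow n a b k).choice (J.registerOf (b k)) (a k)

variable {a : ℕ → I.Priority} {b : ℕ → J.Priority}

theorem follow_succ (k : ℕ) :
    follow n a b (k + 1) = (follow n a b k).update (followChoice n a b k) (a k) := rfl

theorem follow_congr {a' : ℕ → I.Priority} {b' : ℕ → J.Priority} {k : ℕ}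
    (h : ∀ i < k, a i = a' i ∧ b i = b' i) : follow n a b k = follow n a' b' k := by
  induction k with
  | zero => rfl
  | succ k ih =>
    simp only [follow, ih fun i hi => h i (hi.trans k.lt_succ_self), (h k k.lt_succ_self).1,
      (h k k.lt_succ_self).2]

theorem cnt_eq_of_output_odd {c : RegConfig I J n} {j : J.Register} (hj : J.lo ≤ 2 * j.1)
    (h : c.output j ≠ 2 * j.1) : Odd (c.reg j).1 ∧ (c.cnt (c.reg j) j : ℕ) = n := by
  unfold output at h
  rw [if_neg hj.not_gt] at h
  split_ifs at h with h1 h2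
  · exact absurd rfl h
  · exact ⟨Nat.not_even_iff_odd.1 h1, h2⟩
  · exact absurd rfl h

/-- Whenever a state is repeated and the greatest `b` in between is even, so is the greatest `a`. -/
def LoopCondition {S : Type*} (s : ℕ → S) (a b : ℕ → ℕ) (K : ℕ) : Prop :=
  ∀ x y, x < y → y < K → s x = s y → Even ((Finset.Ico x y).sup b) → Even ((Finset.Ico x y).sup a)

/-- The increments since the last reset happen at pairwise different states, so they number at most
`Nat.card S`. A repeated state would close a loop whose greatest `b` is `2q`, hence whose greatest
`a` is even; recording that value in `r_q` would have reset the counter. -/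
theorem cnt_follow_le {S : Type*} [Finite S] {s : ℕ → S} {T K : ℕ} (q : J.Register)
    (k : I.Priority) (hk : Odd k.1)
    (hs : LoopCondition s (fun z => (a z).1) (fun z => (b z).1) K)
    (hb : ∀ z, T ≤ z → z < K → (b z).1 ≤ 2 * q.1)
    (hle : ∀ z, T ≤ z → z < K → followChoice n a b z ≤ q)
    (h0 : (follow n a b T).cnt k q = 0) (y : ℕ) (hTy : T ≤ y) (hyK : y ≤ K) :
    ((follow n a b y).cnt k q : ℕ) ≤ Nat.card S := by
  classical
  -- `X` collects the times of the increments since the last reset; its last clause says that no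
  -- larger priority has been recorded in `r_q` since.
  suffices h : ∃ X : Finset ℕ, ((follow n a b y).cnt k q : ℕ) ≤ X.card ∧ Set.InjOn s X ∧
      ∀ x ∈ X, T ≤ x ∧ x < y ∧ (b x).1 = 2 * q.1 ∧ followChoice n a b x = q ∧
        ∀ z, x ≤ z → z < y → followChoice n a b z = q → a z ≤ k by
    obtain ⟨X, hX, hinj, -⟩ := h
    refine hX.trans ?_
    have := Fintype.ofFinite S
    rw [← Finset.card_image_of_injOn hinj, Nat.card_eq_fintype_card]
    exact Finset.card_le_univ _
  induction y, hTy using Nat.le_induction with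
  | base => exact ⟨∅, by simp [h0], by simp, by simp⟩
  | succ y hTy ih =>
    obtain ⟨X, hX, hinj, hprop⟩ := ih (by omega)
    have hcarry : (followChoice n a b y = q → a y ≤ k) →
        ((follow n a b (y + 1)).cnt k q = (follow n a b y).cnt k q) →
        ∃ X : Finset ℕ, ((follow n a b (y + 1)).cnt k q : ℕ) ≤ X.card ∧ Set.InjOn s X ∧
          ∀ x ∈ X, T ≤ x ∧ x < y + 1 ∧ (b x).1 = 2 * q.1 ∧ followChoice n a b x = q ∧
            ∀ z, x ≤ z → z < y + 1 → followChoice n a b z = q → a z ≤ k := by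
      intro h1 h2
      refine ⟨X, by rw [h2]; exact hX, hinj, fun x hx => ?_⟩
      obtain ⟨p1, p2, p3, p4, p5⟩ := hprop x hx
      refine ⟨p1, by omega, p3, p4, fun z hz1 hz2 hz3 => ?_⟩
      rcases Nat.lt_succ_iff_lt_or_eq.1 hz2 with h | rfl
      · exact p5 z hz1 h hz3
      · exact h1 hz3
    rcases (hle y hTy (by omega)).lt_or_eq with hlt | heq
    · exact hcarry (fun h => absurd h hlt.ne) (by rw [follow_succ, update_cnt_of_lt _ _ _ hlt])
    rcases lt_or_ge k (a y) with hay | hay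
    · exact ⟨∅, by rw [follow_succ, heq, update_cnt_self_of_lt _ _ hay]; simp, by simp, by simp⟩
    by_cases hreg : (follow n a b y).reg q = k
    swap
    · exact hcarry (fun _ => hay) (by
        rw [follow_succ, heq, update_cnt_self_of_le _ _ hay, cntAfterOutput_of_reg_ne _ _ _ hreg])
    -- Here `r_q` holds `k ≥ a y`, so the detour of the choice rule is excluded and `q` was named by
    -- `b y` itself.
    have hby : (b y).1 = 2 * q.1 := by
      have h1 := hb y hTy (by omega)
      have hj0 : J.registerOf (b y) = q := by
        rcases choice_spec (follow n a b y) (J.registerOf (b y)) (a y) with h | h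
        · exact h.1.symm.trans heq
        · have h2 : (follow n a b y).reg (followChoice n a b y) < a y := h.2.2.1
          rw [heq, hreg] at h2
          exact absurd hay h2.not_ge
      have h2 : (b y).1 / 2 = q.1 := congrArg Subtype.val hj0
      omega
    have hnew : ∀ x ∈ X, s x ≠ s y := by
      intro x hx hxy
      obtain ⟨hTx, hxy', hbx, hjx, hnone⟩ := hprop x hx
      have hevb : Even ((Finset.Ico x y).sup fun z => (b z).1) := by
        have : ((Finset.Ico x y).sup fun z => (b z).1) = 2 * q.1 := by
          refine le_antisymm (Finset.sup_le fun z hz => ?_) ?_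
          · rw [Finset.mem_Ico] at hz
            exact hb z (by omega) (by omega)
          · rw [← hbx]
            exact Finset.le_sup (f := fun z => (b z).1) (Finset.mem_Ico.2 ⟨le_rfl, hxy'⟩)
        rw [this]
        exact even_two_mul _
      have heva := hs x y hxy' (by omega) hxy hevb
      set m := (Finset.Ico x y).sup fun z => (a z).1 with hm
      have hle_m : ∀ z, x ≤ z → z < y → (a z).1 ≤ m := fun z h1 h2 =>
        Finset.le_sup (f := fun z => (a z).1) (Finset.mem_Ico.2 ⟨h1, h2⟩)
      have hrecent : ∀ z, x < z → z ≤ y → ∃ z', x ≤ z' ∧ z' < z ∧ (follow n a b z).reg q = a z' :=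
        fun z h1 h2 => exists_reg_eq (follow n a b) (followChoice n a b) a q h1
          (fun z _ => follow_succ z) hjx fun z' h3 h4 => hle z' (by omega) (by omega)
      -- The content `k` of `r_q` was recorded during the loop, so `k ≤ m`; the parities differ.
      have hkm : k.1 < m := by
        obtain ⟨z', h1, h2, h3⟩ := hrecent y hxy' le_rfl
        have h4 := hle_m z' h1 h2
        rw [← h3, hreg] at h4
        refine h4.lt_of_ne fun h => ?_
        rw [← h] at heva
        exact Nat.not_even_iff_odd.2 hk heva
      have hexm : ∃ z, x ≤ z ∧ z < y ∧ (a z).1 = m := by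
        obtain ⟨z, hz, h⟩ := Finset.exists_mem_eq_sup (Finset.Ico x y)
          ⟨x, Finset.mem_Ico.2 ⟨le_rfl, hxy'⟩⟩ fun z => (a z).1
        rw [Finset.mem_Ico] at hz
        exact ⟨z, hz.1, hz.2, h.symm⟩
      -- At the first occurrence of `m`, either this is time `x`, when `q` is chosen, or `r_q` holds
      -- something smaller recorded since `x`. In the latter case the choice rule selects a register
      -- at least `q`, hence `q`.
      obtain ⟨hz1, hz2, hz3⟩ := Nat.find_spec hexm
      have hmin := fun z (hz : z < Nat.find hexm) => Nat.find_min hexm hz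
      set z := Nat.find hexm
      have hjz : followChoice n a b z = q := by
        rcases hz1.lt_or_eq with hlt | heq'
        · refine le_antisymm (hle z (by omega) (by omega)) ?_
          refine le_choice_of_reg_lt _ ?_ (by rw [hz3]; exact heva) ?_
          · exact (le_choice _ _ _).trans (hle z (by omega) (by omega))
          · obtain ⟨z', h1, h2, h3⟩ := hrecent z hlt (by omega)
            rw [h3, ← Subtype.coe_lt_coe, hz3]
            exact (hle_m z' h1 (by omega)).lt_of_ne fun h => hmin z' h2 ⟨h1, by omega, h⟩
        · rw [← heq', hjx]
      have h5 : (a z).1 ≤ k.1 := hnone z hz1 hz2 hjz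
      omega
    have hyX : y ∉ X := fun h => (hprop y h).2.1.false
    refine ⟨insert y X, ?_, ?_, ?_⟩
    · rw [Finset.card_insert_of_notMem hyX, follow_succ, heq, update_cnt_self_of_le _ _ hay]
      have hlo : J.lo ≤ 2 * q.1 := hby ▸ (b y).2.1
      have h1 := cntAfterOutput_reg (follow n a b y) q hlo (by rw [hreg]; exact hk)
      rw [hreg] at h1
      rw [h1, Fin.val_add_one]
      split_ifs <;> omega
    · rw [Finset.coe_insert, Set.injOn_insert (by simpa using hyX)]
      refine ⟨hinj, ?_⟩
      rintro ⟨x, hx, h⟩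
      exact hnew x hx h
    · intro x hx
      rcases Finset.mem_insert.1 hx with rfl | hx
      · refine ⟨hTy, by omega, hby, heq, fun z h1 h2 h3 => ?_⟩
        obtain rfl : z = x := by omega
        exact hay
      · obtain ⟨p1, p2, p3, p4, p5⟩ := hprop x hx
        refine ⟨p1, by omega, p3, p4, fun z hz1 hz2 hz3 => ?_⟩
        rcases Nat.lt_succ_iff_lt_or_eq.1 hz2 with h | rfl
        · exact p5 z hz1 h hz3
        · exact hay

theorem two_mul_register_le (j : J.Register) : 2 * j.1 ≤ J.hi := by
  have := J.lo_le_hi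
  rcases j.2 with h' | h'
  · exact h'.2
  · omega

/-- The output can leave `J` only if `J.hi = 2q` and a counter of the top register `q` is full. For
this register the bounds of `cnt_follow_le` hold from time `0`. -/
theorem output_follow_mem {S : Type*} [Finite S] {s : ℕ → S} {K : ℕ} (hn : Nat.card S < n)
    (hs : LoopCondition s (fun z => (a z).1) (fun z => (b z).1) K) {z : ℕ} (hz : z < K) :
    (follow n a b z).output (followChoice n a b z) ∈ Set.Icc J.lo J.hi := by
  set q := followChoice n a b z with hq
  have h1 := two_mul_le_output (follow n a b z) q
  have h2 := output_le (follow n a b z) q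
  have h3 := two_mul_register_le q
  have hlohi := J.lo_le_hi
  rcases lt_or_ge (2 * q.1) J.lo with hlo | hlo
  · have : (follow n a b z).output q = 2 * q.1 + 1 := by simp [output, hlo]
    rcases q.2 with h' | h'
    · exact absurd h'.1 hlo.not_ge
    · rw [this, h']
      exact ⟨le_rfl, hlohi⟩
  refine ⟨by omega, ?_⟩
  by_contra hhi
  obtain ⟨hodd, hfull⟩ := cnt_eq_of_output_odd (c := follow n a b z) hlo (by omega)
  have := cnt_follow_le (n := n) (T := 0) q _ hodd hs (fun z _ _ => (b z).2.2.trans (by omega))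
    (fun z _ _ => Subtype.coe_le_coe.1 (by
      have := two_mul_register_le (followChoice n a b z)
      omega)) rfl z (Nat.zero_le _) hz.le
  omega

/-- With `m = 2q` the limsup of `b`, eventually no register above `q` is chosen and `r_q` always
outputs `2q`, while smaller registers output less than `2q`. So `m` is also the limsup of the
outputs. -/
theorem parityAccepting_output_follow {S : Type*} [Finite S] {s : ℕ → S} (hn : Nat.card S < n)
    (hs : ∀ K, LoopCondition s (fun z => (a z).1) (fun z => (b z).1) K)
    (hacc : ParityAccepting fun z => (b z).1) :
    ParityAccepting fun z => (follow n a b z).output (followChoice n a b z) := by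
  obtain ⟨m, hm, hfreq, hev⟩ := hacc
  obtain ⟨x₀, hx₀ : (b x₀).1 = m⟩ := hfreq.exists
  set q := J.registerOf (b x₀) with hq
  have hqm : 2 * q.1 = m := by
    have : q.1 = (b x₀).1 / 2 := rfl
    obtain ⟨m', rfl⟩ := hm
    omega
  have hlo : J.lo ≤ 2 * q.1 := by
    rw [hqm, ← hx₀]
    exact (b x₀).2.1
  obtain ⟨T₀, hT₀⟩ := Filter.eventually_atTop.1 hev
  have hreg0 : ∀ z, T₀ ≤ z → J.registerOf (b z) ≤ q := by
    intro z hz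
    have h1 : (J.registerOf (b z)).1 = (b z).1 / 2 := rfl
    have h2 : (b z).1 ≤ m := hT₀ z hz
    exact Subtype.coe_le_coe.1 (by omega)
  -- From `T₀` on, a register above `q` is chosen only to receive a larger priority, and no other
  -- move lowers it.
  have habove : ∀ j, q < j → ∀ᶠ z in Filter.atTop, followChoice n a b z ≠ j := by
    intro j hj
    have hup : ∀ z, T₀ ≤ z → followChoice n a b z = j →
        ((follow n a b z).reg j).1 < (follow n a b (z + 1)).reg j := by
      intro z hz h
      rcases choice_spec (follow n a b z) (J.registerOf (b z)) (a z) with h' | h'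
      · exact absurd (h'.1.symm.trans h ▸ hreg0 z hz) hj.not_ge
      · rw [follow_succ, h, update_reg_self, ← h]
        exact h'.2.2.1
    obtain ⟨T', hT', hconst⟩ := eventually_const_of_mono_of_bounded
      (fun z => ((follow n a b z).reg j).1) I.hi T₀ (fun z => ((follow n a b z).reg j).2.2) (by
        intro z hz
        rcases lt_trichotomy (followChoice n a b z) j with h | h | h
        · rw [follow_succ, update_reg_of_lt _ _ h]
          exact le_max_right (a z) _
        · exact (hup z hz h).le
        · rw [follow_succ, update_reg_of_gt _ _ h])
    filter_upwards [Filter.eventually_ge_atTop T'] with z hz h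
    exact (hup z (hT'.trans hz) h).ne' (hconst z hz)
  have hle : ∀ᶠ z in Filter.atTop, followChoice n a b z ≤ q := by
    have : ∀ᶠ z in Filter.atTop, ∀ j, q < j → followChoice n a b z ≠ j :=
      Filter.eventually_all.2 fun j => by
        by_cases h : q < j
        · exact (habove j h).mono fun z hz _ => hz
        · exact Filter.Eventually.of_forall fun z h' => absurd h' h
    filter_upwards [this] with z hz
    exact not_lt.1 fun h => hz _ h rfl
  obtain ⟨T₁, hT₁⟩ := Filter.eventually_atTop.1 hle
  set T := max T₀ T₁
  have hgood : ∀ᶠ z in Filter.atTop,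
      followChoice n a b z = q → (follow n a b z).output q = 2 * q.1 := by
    have hbad : ∀ k : I.Priority, Odd k.1 → ∀ᶠ z in Filter.atTop,
        ¬ (followChoice n a b z = q ∧ (follow n a b z).reg q = k ∧
          ((follow n a b z).cnt k q : ℕ) = n) := by
      intro k hk
      by_contra hcon
      have hf := Filter.frequently_atTop.1 (Filter.not_eventually.1 hcon)
      obtain ⟨z, hz, h⟩ := hf T
      obtain ⟨hj, hr, hfull⟩ := not_not.1 h
      -- A full counter returns to `0` in this very step, by a reset or by wrapping modulo `n + 1`.
      -- From then on `cnt_follow_le` and `Nat.card S < n` keep it from being full again.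
      have hnext : ∃ T', T ≤ T' ∧ (follow n a b T').cnt k q = 0 := by
        refine ⟨z + 1, by omega, ?_⟩
        rw [follow_succ, hj]
        rcases lt_or_ge k (a z) with h1 | h1
        · exact update_cnt_self_of_lt _ _ h1
        · rw [update_cnt_self_of_le _ _ h1]
          have h2 := cntAfterOutput_reg (follow n a b z) q hlo (by rw [hr]; exact hk)
          rw [hr] at h2
          rw [h2, show (follow n a b z).cnt k q = Fin.last n from Fin.ext hfull]
          exact Fin.last_add_one n
      obtain ⟨T', hT', h0⟩ := hnext
      obtain ⟨z', hz', h'⟩ := hf T'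
      have h3 := cnt_follow_le (T := T') q k hk (hs z')
        (fun z h _ => (hT₀ z (by omega)).trans hqm.ge) (fun z h _ => hT₁ z (by omega)) h0
        z' hz' le_rfl
      have h4 := (not_not.1 h').2.2
      omega
    have hall : ∀ᶠ z in Filter.atTop, ∀ k : I.Priority, Odd k.1 →
        ¬ (followChoice n a b z = q ∧ (follow n a b z).reg q = k ∧
          ((follow n a b z).cnt k q : ℕ) = n) :=
      Filter.eventually_all.2 fun k => by
        by_cases hk : Odd k.1
        · exact (hbad k hk).mono fun z hz _ => hz
        · exact Filter.Eventually.of_forall fun z h => absurd h hk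
    filter_upwards [hall] with z hz hj
    by_contra hne
    obtain ⟨h1, h2⟩ := cnt_eq_of_output_odd hlo hne
    exact hz _ h1 ⟨hj, rfl, h2⟩
  refine ⟨m, hm, ?_, ?_⟩
  · refine (hfreq.and_eventually (hgood.and (hle.and (Filter.eventually_ge_atTop T₀)))).mono ?_
    rintro z ⟨hbz, hg, hlez, hz⟩
    have hj : followChoice n a b z = q := by
      refine le_antisymm hlez ?_
      refine le_trans (le_of_eq ?_) (le_choice (follow n a b z) (J.registerOf (b z)) (a z))
      refine Subtype.ext ?_
      have h1 : (J.registerOf (b z)).1 = (b z).1 / 2 := rfl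
      simp only at hbz
      omega
    simp only [hj, hg hj, hqm]
  · filter_upwards [hgood, hle] with z hg hlez
    rcases hlez.lt_or_eq with h | h
    · have h1 := output_le (follow n a b z) (followChoice n a b z)
      have h2 : (followChoice n a b z).1 < q.1 := h
      omega
    · simp only [h, hg h, hqm, le_refl]

end RegConfig
/-! ### Completion of an automaton -/

namespace TreeAutomaton

variable {α : Type*} {I J K : Index}

/-- The completion of `B` by a sink, whose transitions have the priority `p`. -/
noncomputable def completion (B : TreeAutomaton α J) (K : Index) (hlo : K.lo ≤ J.lo)
    (hhi : J.hi ≤ K.hi) (p : K.Priority) : TreeAutomaton α K where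
  Q := Option B.Q
  finite_Q := by
    have := B.finite_Q
    infer_instance
  init := some B.init
  trans := {e | (∃ f : B.trans, e = (some (B.src f), B.letter f, some (B.child f false),
    some (B.child f true))) ∨ ∃ q a, e = (q, a, none, none)}
  prio e b :=
    open Classical in
    if h : ∃ f : B.trans, e.1 = (some (B.src f), B.letter f, some (B.child f false),
      some (B.child f true)) then
      ⟨B.prio h.choose b, hlo.trans (B.prio _ _).2.1, (B.prio _ _).2.2.trans hhi⟩
    else p

section Completion

variable (B : TreeAutomaton α J) (hlo : K.lo ≤ J.lo) (hhi : J.hi ≤ K.hi) (p : K.Priority)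

/-- The transitions of an automaton are transitions of its completion. -/
def embed (f : B.trans) : (B.completion K hlo hhi p).trans :=
  ⟨(some (B.src f), B.letter f, some (B.child f false), some (B.child f true)), Or.inl ⟨f, rfl⟩⟩

theorem completion_isComplete : (B.completion K hlo hhi p).IsComplete :=
  fun q a => ⟨⟨(q, a, none, none), Or.inr ⟨q, a, rfl⟩⟩, rfl, rfl⟩

theorem eq_of_shape_eq {f f' : B.trans}
    (h : ((some (B.src f), B.letter f, some (B.child f false), some (B.child f true)) :
      Option B.Q × α × Option B.Q × Option B.Q) =
      (some (B.src f'), B.letter f', some (B.child f' false), some (B.child f' true))) :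
    f = f' := by
  obtain ⟨⟨q, a, q₀, q₁⟩, hf⟩ := f
  obtain ⟨⟨q', a', q₀', q₁'⟩, hf'⟩ := f'
  simp [src, letter, child] at h
  simp [h]

theorem prio_embed (f : B.trans) (b : Bool) :
    ((B.completion K hlo hhi p).prio (B.embed hlo hhi p f) b : ℕ) = B.prio f b := by
  have h : ∃ f' : B.trans, (B.embed hlo hhi p f).1 = (some (B.src f'), B.letter f',
    some (B.child f' false), some (B.child f' true)) := ⟨f, rfl⟩
  have h2 : h.choose = f := (B.eq_of_shape_eq h.choose_spec).symm
  have h3 : ((B.completion K hlo hhi p).prio (B.embed hlo hhi p f) b : ℕ) = B.prio h.choose b :=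
    congrArg Subtype.val (dif_pos h)
  rw [h3, h2]

theorem child_embed (f : B.trans) (b : Bool) :
    (B.completion K hlo hhi p).child (B.embed hlo hhi p f) b = some (B.child f b) := by
  cases b <;> rfl

theorem isAcceptingRun_embed_iff {t : LTree α} {ρ : LTree B.trans} :
    (B.completion K hlo hhi p).IsAcceptingRun t (fun w => B.embed hlo hhi p (ρ w)) ↔
      B.IsAcceptingRun t ρ := by
  have hsrc : ∀ f, (B.completion K hlo hhi p).src (B.embed hlo hhi p f) = some (B.src f) :=
    fun _ => rfl
  have hinit : (B.completion K hlo hhi p).init = some B.init := rfl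
  have hlet : ∀ f, (B.completion K hlo hhi p).letter (B.embed hlo hhi p f) = B.letter f :=
    fun _ => rfl
  unfold IsAcceptingRun IsRun
  simp only [child_embed, prio_embed, hsrc, hinit, hlet]
  refine and_congr (and_congr Option.some_inj (and_congr Iff.rfl ?_)) Iff.rfl
  exact forall_congr' fun w => forall_congr' fun b => Option.some_inj

/-- The sink cannot be left and only shows the odd priority `p`, so an accepting run never enters
it. -/
theorem exists_embed_of_isAcceptingRun (hp : Odd p.1) {t : LTree α}
    {ρ : LTree (B.completion K hlo hhi p).trans}
    (hρ : (B.completion K hlo hhi p).IsAcceptingRun t ρ) (w : List Bool) :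
    ∃ f, B.embed hlo hhi p f = ρ w := by
  have hsink : ∀ w, (B.completion K hlo hhi p).src (ρ w) = none →
      (∀ b, (B.completion K hlo hhi p).child (ρ w) b = none) ∧
        ∀ b, (B.completion K hlo hhi p).prio (ρ w) b = p := by
    intro w hw
    have hno : ¬ ∃ f : B.trans, (ρ w).1 = (some (B.src f), B.letter f, some (B.child f false),
        some (B.child f true)) := by
      rintro ⟨f, hf⟩
      have : (ρ w).1.1 = none := hw
      rw [hf] at this
      exact Option.some_ne_none _ this
    refine ⟨fun b => ?_, fun b => ?_⟩
    · rcases (ρ w).2 with h | ⟨q, a, h⟩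
      · exact absurd h hno
      · have h' : (ρ w).1 = (q, a, none, none) := h
        cases b <;> simp [child, h'] <;> rfl
    · exact dif_neg hno
  have hnone : ∀ w, (B.completion K hlo hhi p).src (ρ w) ≠ none := by
    intro w hw
    have key : ∀ k, (B.completion K hlo hhi p).src
        (ρ (branchPrefix (branchThrough w) (w.length + k))) = none := by
      intro k
      induction k with
      | zero => rwa [Nat.add_zero, branchPrefix_branchThrough]
      | succ k ih =>
        rw [← Nat.add_assoc, branchPrefix_succ, hρ.1.2.2]
        exact (hsink _ ih).1 _
    have h := hρ.2 (branchThrough w)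
    rw [← parityAccepting_shift _ w.length] at h
    simp only [(hsink _ (key _)).2] at h
    exact Nat.not_even_iff_odd.2 hp ((parityAccepting_const _).1 h)
  rcases (ρ w).2 with ⟨f, hf⟩ | ⟨q, a, hf⟩
  · exact ⟨f, Subtype.ext hf.symm⟩
  · refine absurd ?_ (hnone (w ++ [false]))
    rw [hρ.1.2.2]
    have : (ρ w).1 = (q, a, none, none) := hf
    simp [child, this]
    rfl

theorem completion_language (hp : Odd p.1) :
    (B.completion K hlo hhi p).language = B.language := by
  ext t
  rw [mem_language_iff, mem_language_iff]
  constructor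
  · rintro ⟨ρ, hρ⟩
    choose ρ' hρ' using B.exists_embed_of_isAcceptingRun hlo hhi p hp hρ
    refine ⟨ρ', (B.isAcceptingRun_embed_iff hlo hhi p).1 ?_⟩
    simpa only [hρ'] using hρ
  · rintro ⟨ρ, hρ⟩
    exact ⟨_, (B.isAcceptingRun_embed_iff hlo hhi p).2 hρ⟩

end Completion

/-! ### Pumping accepting runs -/

theorem parityAccepting_periodic (f : ℕ → ℕ) (x : ℕ) {d : ℕ} (hd : 0 < d) :
    ParityAccepting (fun k => f (x + k % d)) ↔ Even ((Finset.Ico x (x + d)).sup f) := by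
  rw [← parityAccepting_blockSup hd]
  have : blockSup d (fun k => f (x + k % d)) = fun _ => (Finset.Ico x (x + d)).sup f := by
    funext k
    unfold blockSup
    refine le_antisymm (Finset.sup_le fun i hi => ?_) (Finset.sup_le fun z hz => ?_)
    · have hi := Finset.mem_range.1 hi
      simp only [Nat.mul_add_mod, Nat.mod_eq_of_lt hi]
      exact Finset.le_sup (Finset.mem_Ico.2 ⟨by omega, by omega⟩)
    · have hz := Finset.mem_Ico.1 hz
      have h := Finset.le_sup (f := fun i => f (x + (d * k + i) % d))
        (Finset.mem_range.2 (show z - x < d by omega))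
      simp only [Nat.mul_add_mod, Nat.mod_eq_of_lt (show z - x < d by omega),
        Nat.add_sub_cancel' hz.1] at h
      simpa only [Nat.mul_add_mod] using h
  rw [this, parityAccepting_const]

theorem guidedState_append (A : TreeAutomaton α I) (B : TreeAutomaton α K)
    (g : A.Q → B.trans → A.trans) (q : A.Q) (ρ : LTree B.trans) (w : List Bool) (b : Bool) :
    guidedState A B g q ρ (w ++ [b]) = A.child (g (guidedState A B g q ρ w) (ρ w)) b := by
  induction w generalizing q ρ with
  | nil => rfl
  | cons c w ih => exact ih _ _

/-- The node reached by following `w`, jumping back to `U` whenever `V` is reached. -/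
def pump (U V : List Bool) (w : List Bool) : List Bool :=
  w.foldl (fun u b => if u ++ [b] = V then U else u ++ [b]) []

theorem pump_append (U V w : List Bool) (b : Bool) :
    pump U V (w ++ [b]) = if pump U V w ++ [b] = V then U else pump U V w ++ [b] := by
  unfold pump
  rw [List.foldl_append]
  rfl

theorem pump_branchPrefix_succ (U V : List Bool) (γ : ℕ → Bool) (i : ℕ) :
    pump U V (branchPrefix γ (i + 1)) = if pump U V (branchPrefix γ i) ++ [γ i] = V then U
      else pump U V (branchPrefix γ i) ++ [γ i] := by
  rw [branchPrefix_succ, pump_append]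

theorem succ_mod_eq_ite {d : ℕ} (hd : 0 < d) (k : ℕ) :
    (k + 1) % d = if k % d + 1 = d then 0 else k % d + 1 := by
  have h := Nat.mod_lt k hd
  rw [← Nat.mod_add_mod]
  split_ifs with h'
  · rw [h', Nat.mod_self]
  · exact Nat.mod_eq_of_lt (by omega)

/-- Along a branch that follows the loop between two nodes of `β`, the pumping goes around. -/
theorem pump_loop {β γ : ℕ → Bool} {x d a : ℕ} (hd : 0 < d)
    (ha : pump (branchPrefix β x) (branchPrefix β (x + d)) (branchPrefix γ a) = branchPrefix β x)
    (hγ : ∀ k, pump (branchPrefix β x) (branchPrefix β (x + d)) (branchPrefix γ (a + k)) =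
      branchPrefix β (x + k % d) → γ (a + k) = β (x + k % d)) (k : ℕ) :
    pump (branchPrefix β x) (branchPrefix β (x + d)) (branchPrefix γ (a + k)) =
      branchPrefix β (x + k % d) := by
  induction k with
  | zero => simpa using ha
  | succ k ih =>
    rw [← Nat.add_assoc, pump_branchPrefix_succ, ih, hγ k ih, ← branchPrefix_succ,
      succ_mod_eq_ite hd]
    have h := Nat.mod_lt k hd
    by_cases h' : k % d + 1 = d
    · rw [if_pos h', if_pos (by rw [Nat.add_assoc, h']), Nat.add_zero]
    · rw [if_neg h', if_neg, Nat.add_assoc]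
      intro h2
      have := congrArg List.length h2
      simp only [length_branchPrefix] at this
      omega

/-- Between jumps the pumped node only descends. If it later reaches `V`, all its steps since then
lie on the path to `V`. -/
theorem prefix_pump {U V : List Bool} {γ : ℕ → Bool} {i k : ℕ}
    (h : ∀ z, i ≤ z → z < i + k → pump U V (branchPrefix γ z) ++ [γ z] ≠ V) :
    pump U V (branchPrefix γ i) ++ [γ i] <+: pump U V (branchPrefix γ (i + k)) ++ [γ (i + k)] := by
  induction k with
  | zero => exact List.prefix_rfl
  | succ k ih =>
    rw [← Nat.add_assoc, pump_branchPrefix_succ, if_neg (h _ (by omega) (by omega))]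
    exact (ih fun z h1 h2 => h z h1 (by omega)).trans (List.prefix_append _ _)

theorem eq_of_prefix_branchPrefix {β : ℕ → Bool} {m y : ℕ} {b : Bool}
    (h : branchPrefix β m ++ [b] <+: branchPrefix β y) : b = β m := by
  have h1 := h.getElem (i := m) (by simp [length_branchPrefix])
  simpa [branchPrefix] using h1

variable {A : TreeAutomaton α I} {B : TreeAutomaton α K} {t : LTree α} {ρ : LTree B.trans}

/-- A branch with finitely many jumps ends like a branch of `ρ`. One with infinitely many jumps must
follow the path from one node to the other each time, so its priorities become periodic with an even
maximum. -/
theorem isAcceptingRun_pump (hρ : B.IsAcceptingRun t ρ) {β : ℕ → Bool} {x d : ℕ} (hd : 0 < d)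
    (hsrc : B.src (ρ (branchPrefix β x)) = B.src (ρ (branchPrefix β (x + d))))
    (heven : Even ((Finset.Ico x (x + d)).sup fun z => (B.prio (ρ (branchPrefix β z)) (β z)).1)) :
    B.IsAcceptingRun (fun w => t (pump (branchPrefix β x) (branchPrefix β (x + d)) w))
      fun w => ρ (pump (branchPrefix β x) (branchPrefix β (x + d)) w) := by
  set U := branchPrefix β x
  set V := branchPrefix β (x + d)
  refine ⟨⟨hρ.1.1, fun w => hρ.1.2.1 _, fun w b => ?_⟩, fun γ => ?_⟩
  · simp only [pump_append]
    split_ifs with h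
    · have h2 := hρ.1.2.2 (pump U V w) b
      rw [h] at h2
      rw [hsrc, h2]
    · rw [hρ.1.2.2]
  by_cases hfin : ∃ i₀, ∀ i, i₀ ≤ i → pump U V (branchPrefix γ i) ++ [γ i] ≠ V
  · obtain ⟨i₀, hi₀⟩ := hfin
    set u := pump U V (branchPrefix γ i₀) with hu
    -- After its last jump the branch is at the node `u` of `ρ`; `γ'` is the branch of `ρ` through
    -- `u` that copies the later directions.
    let γ' : ℕ → Bool := fun i =>
      if i < u.length then branchThrough u i else γ (i₀ + (i - u.length))
    have hγ' : ∀ k, γ' (u.length + k) = γ (i₀ + k) := fun k => by simp [γ']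
    have hpre : ∀ k, pump U V (branchPrefix γ (i₀ + k)) = branchPrefix γ' (u.length + k) := by
      intro k
      induction k with
      | zero =>
        rw [Nat.add_zero, Nat.add_zero, ← hu,
          branchPrefix_congr (β := γ') (β' := branchThrough u) fun i hi => if_pos hi,
          branchPrefix_branchThrough]
      | succ k ih =>
        rw [← Nat.add_assoc, pump_branchPrefix_succ, if_neg (hi₀ _ (by omega)), ih,
          ← Nat.add_assoc, branchPrefix_succ, hγ']
    rw [← parityAccepting_shift _ i₀]
    have h := hρ.2 γ'
    rw [← parityAccepting_shift _ u.length] at h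
    simpa only [hpre, hγ'] using h
  · have hinf : ∀ i₀, ∃ i, i₀ ≤ i ∧ pump U V (branchPrefix γ i) ++ [γ i] = V := by
      intro i₀
      by_contra h
      exact hfin ⟨i₀, fun i h1 h2 => h ⟨i, h1, h2⟩⟩
    obtain ⟨a, -, ha⟩ := hinf 0
    have ha' : pump U V (branchPrefix γ (a + 1)) = U := by rw [pump_branchPrefix_succ, if_pos ha]
    -- The next jump forces the direction: until then the node stays on the path to `V`, which is a
    -- prefix of `β`.
    have hγ : ∀ k, pump U V (branchPrefix γ (a + 1 + k)) = branchPrefix β (x + k % d) →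
        γ (a + 1 + k) = β (x + k % d) := by
      intro k hk
      have hex := hinf (a + 1 + k)
      obtain ⟨h1, h2⟩ := Nat.find_spec hex
      have hmin := fun z (hz : z < Nat.find hex) => Nat.find_min hex hz
      obtain ⟨l, hl⟩ := Nat.exists_eq_add_of_le h1
      rw [hl] at h2 hmin
      have h3 := prefix_pump (U := U) (V := V) (γ := γ) (i := a + 1 + k) (k := l)
        fun z h4 h5 h6 => hmin z h5 ⟨h4, h6⟩
      rw [h2, hk] at h3
      exact eq_of_prefix_branchPrefix h3
    have hloop := pump_loop hd ha' hγ
    rw [← parityAccepting_shift _ (a + 1)]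
    have h := (parityAccepting_periodic
      (fun z => (B.prio (ρ (branchPrefix β z)) (β z)).1) x hd).2 heven
    convert h using 5 with k
    · rw [hloop]
    · exact hγ k (hloop k)

/-- A jump preserves the guided state, so guiding commutes with pumping. -/
theorem guidedState_pump {g : A.Q → B.trans → A.trans} {U V : List Bool}
    (hstate : guidedState A B g A.init ρ U = guidedState A B g A.init ρ V) (w : List Bool) :
    guidedState A B g A.init (fun w => ρ (pump U V w)) w =
      guidedState A B g A.init ρ (pump U V w) := by
  induction w using List.reverseRecOn with
  | nil => rfl
  | append_singleton w b ih =>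
    rw [guidedState_append, ih, pump_append]
    split_ifs with h
    · have h2 := guidedState_append A B g A.init ρ (pump U V w) b
      rw [h] at h2
      rw [hstate, h2]
    · rw [guidedState_append]

/-- A guiding function that preserves acceptance maps accepting loops to accepting loops. -/
theorem even_loop_of_guides {g : A.Q → B.trans → A.trans}
    (hg : ∀ t ρ, B.IsAcceptingRun t ρ → A.IsAcceptingRun t (guidedRun A B g ρ))
    (hρ : B.IsAcceptingRun t ρ) {β : ℕ → Bool} {x y : ℕ} (hxy : x < y)
    (hsrc : B.src (ρ (branchPrefix β x)) = B.src (ρ (branchPrefix β y)))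
    (hstate : guidedState A B g A.init ρ (branchPrefix β x) =
      guidedState A B g A.init ρ (branchPrefix β y))
    (heven : Even ((Finset.Ico x y).sup fun z => (B.prio (ρ (branchPrefix β z)) (β z)).1)) :
    Even ((Finset.Ico x y).sup fun z =>
      (A.prio (guidedRun A B g ρ (branchPrefix β z)) (β z)).1) := by
  obtain ⟨d, rfl⟩ := Nat.exists_eq_add_of_le hxy.le
  have hd : 0 < d := by omega
  have hacc := hg _ _ (isAcceptingRun_pump hρ hd hsrc heven)
  -- The branch that reaches the loop and then goes around it for ever; on it the priorities of the
  -- guided run are periodic, and acceptance gives the parity of their maximum.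
  let γ : ℕ → Bool := fun i => if i < x then β i else β (x + (i - x) % d)
  have hγ : ∀ k, γ (x + k) = β (x + k % d) := fun k => by simp [γ]
  have hbefore : ∀ i ≤ x, pump (branchPrefix β x) (branchPrefix β (x + d)) (branchPrefix γ i) =
      branchPrefix β i := by
    intro i hi
    induction i with
    | zero => rfl
    | succ i ih =>
      rw [pump_branchPrefix_succ, ih (by omega), show γ i = β i from if_pos (by omega),
        ← branchPrefix_succ, if_neg]
      intro h
      have := congrArg List.length h
      simp only [length_branchPrefix] at this
      omega
  have hloop := pump_loop hd (hbefore x le_rfl) fun k _ => hγ k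
  have h := hacc.2 γ
  rw [← parityAccepting_shift _ x] at h
  rw [← parityAccepting_periodic _ x hd]
  convert h using 2 with k
  simp only [guidedRun, guidedState_pump hstate, hloop, hγ]

end TreeAutomaton
/-! ### Winning the priority transduction game -/

namespace ParityGame

variable {V : Type*} {I J : Index} {n : ℕ}

open Classical in
/-- The label of an edge as a priority of the index. -/
noncomputable def edgePriority (G : ParityGame V I) (u v : V) : I.Priority :=
  if h : G.label u v ∈ Set.Icc I.lo I.hi then ⟨_, h⟩ else ⟨I.lo, le_rfl, I.lo_le_hi⟩

theorem edgePriority_val {G : ParityGame V I} {u v : V} (h : G.edge u v) :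
    (G.edgePriority u v).1 = G.label u v := by
  unfold edgePriority
  rw [dif_pos (G.label_mem u v h)]

/-- Eve's positional strategy that plays `τ` in `G`, chooses registers according to the priorities
`b`, and records the labels. -/
noncomputable def regStrategy (G : ParityGame V I) (τ : V → V) (b : V → V → J.Priority) :
    RegPos V I J n → RegPos V I J n
  | .vertex u c => .taken u (τ u) c
  | .taken u v c => .chosen u v c (c.choice (J.registerOf (b u v)) (G.edgePriority u v))
  | .chosen u v c j => .vertex v (c.update j (G.edgePriority u v))

/-- The vertex of the underlying game that is reached or about to be reached. -/
def targetVertex : RegPos V I J n → V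
  | .vertex u _ => u
  | .taken _ v _ => v
  | .chosen _ v _ _ => v

/-- The play of the underlying game. -/
def projectPlay (G : ParityGame V I) (P : ℕ → RegPos V I J n) : ℕ → V
  | 0 => G.init
  | k + 1 => targetVertex (P (3 * k + 1))

theorem play_of_regStrategy {G : ParityGame V I} {τ : V → V} {b : V → V → J.Priority}
    {P : ℕ → RegPos V I J n} {N : ℕ}
    (hP : (Reg J n G).PositionallyConsistent (G.regStrategy τ b) P N) (v : ℕ → V)
    (hv : v = G.projectPlay P) (a' : ℕ → I.Priority) (b' : ℕ → J.Priority)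
    (ha' : a' = fun k => G.edgePriority (v k) (v (k + 1)))
    (hb' : b' = fun k => b (v k) (v (k + 1))) (k : ℕ) :
    (3 * k ≤ N → P (3 * k) = .vertex (v k) (RegConfig.follow n a' b' k)) ∧
    (3 * k + 1 ≤ N → P (3 * k + 1) = .taken (v k) (v (k + 1)) (RegConfig.follow n a' b' k) ∧
      G.edge (v k) (v (k + 1)) ∧ (G.eve (v k) → v (k + 1) = τ (v k))) ∧
    (3 * k + 2 ≤ N → P (3 * k + 2) = .chosen (v k) (v (k + 1)) (RegConfig.follow n a' b' k)
      (RegConfig.followChoice n a' b' k)) := by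
  have hnext : ∀ k, (3 * k ≤ N → P (3 * k) = .vertex (v k) (RegConfig.follow n a' b' k)) →
      (3 * k + 1 ≤ N → P (3 * k + 1) = .taken (v k) (v (k + 1)) (RegConfig.follow n a' b' k) ∧
        G.edge (v k) (v (k + 1)) ∧ (G.eve (v k) → v (k + 1) = τ (v k))) ∧
      (3 * k + 2 ≤ N → P (3 * k + 2) = .chosen (v k) (v (k + 1)) (RegConfig.follow n a' b' k)
        (RegConfig.followChoice n a' b' k)) := by
    intro k hk
    have h1 : 3 * k + 1 ≤ N → P (3 * k + 1) =
        .taken (v k) (v (k + 1)) (RegConfig.follow n a' b' k) ∧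
        G.edge (v k) (v (k + 1)) ∧ (G.eve (v k) → v (k + 1) = τ (v k)) := by
      intro hN
      obtain ⟨he, hs⟩ := hP.2 (3 * k) (by omega)
      rw [hk (by omega)] at he hs
      have hvk : v (k + 1) = targetVertex (P (3 * k + 1)) := by rw [hv]; rfl
      cases hx : P (3 * k + 1) with
      | vertex => rw [hx] at he; exact he.elim
      | chosen => rw [hx] at he; exact he.elim
      | taken u' w c' =>
        rw [hx] at he hs hvk
        obtain ⟨rfl, rfl, he⟩ := he
        have hw : v (k + 1) = w := hvk
        subst hw
        refine ⟨rfl, he, fun hev => ?_⟩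
        have := hs hev
        simp only [regStrategy, RegPos.taken.injEq, true_and, and_true] at this
        exact this
    refine ⟨h1, fun hN => ?_⟩
    have h2 := (hP.2 (3 * k + 1) (by omega)).2
    rw [(h1 (by omega)).1] at h2
    refine (h2 trivial).trans ?_
    simp only [regStrategy, RegConfig.followChoice, ha', hb']
  induction k with
  | zero => exact ⟨fun _ => by rw [hv]; exact hP.1, hnext 0 fun _ => by rw [hv]; exact hP.1⟩
  | succ k ih =>
    have h0 : 3 * (k + 1) ≤ N →
        P (3 * (k + 1)) = .vertex (v (k + 1)) (RegConfig.follow n a' b' (k + 1)) := by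
      intro hN
      have h2 := (hP.2 (3 * k + 2) (by omega)).2
      rw [ih.2.2 (by omega)] at h2
      refine (h2 trivial).trans ?_
      simp only [regStrategy, RegConfig.follow_succ, ha']
    exact ⟨h0, hnext (k + 1) h0⟩

/-- Against `regStrategy` the registers evolve deterministically as `follow`, so winning becomes a
statement about plays of `G` alone: the outputs stay in `J` and are parity accepting. -/
theorem Reg_eveWins (G : ParityGame V I) (τ : V → V) (b : V → V → J.Priority)
    (hlegal : ∀ p k, G.PositionallyConsistent τ p k → G.eve (p k) → G.edge (p k) (τ (p k)))
    (hout : ∀ p K, G.PositionallyConsistent τ p K →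
      ∀ a' b', a' = (fun k => G.edgePriority (p k) (p (k + 1))) →
      b' = (fun k => b (p k) (p (k + 1))) → ∀ k < K,
      (RegConfig.follow n a' b' k).output (RegConfig.followChoice n a' b' k) ∈
        Set.Icc J.lo J.hi)
    (hacc : ∀ p, (∀ K, G.PositionallyConsistent τ p K) →
      ∀ a' b', a' = (fun k => G.edgePriority (p k) (p (k + 1))) →
      b' = (fun k => b (p k) (p (k + 1))) → ParityAccepting fun k =>
        (RegConfig.follow n a' b' k).output (RegConfig.followChoice n a' b' k)) :
    (Reg J n G).EveWins := by
  -- The edge number `k` of `G`, counted from `0`, is known after `3k + 1` moves; this explains the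
  -- slack of `2`.
  have hproj : ∀ (P : ℕ → RegPos V I J n) N K,
      (Reg J n G).PositionallyConsistent (G.regStrategy τ b) P N → 3 * K ≤ N + 2 →
      G.PositionallyConsistent τ (G.projectPlay P) K := by
    intro P N K hP hK
    refine ⟨rfl, fun k hk => ?_⟩
    exact ((play_of_regStrategy hP _ rfl _ _ rfl rfl k).2.1 (by omega)).2
  refine eveWins_of_positional _ (G.regStrategy τ b) (fun P N hP hev => ?_) fun P hP => ?_
  · have hplay := play_of_regStrategy hP _ rfl _ _ rfl rfl
    obtain ⟨k, rfl | rfl | rfl⟩ : ∃ k, N = 3 * k ∨ N = 3 * k + 1 ∨ N = 3 * k + 2 :=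
      ⟨N / 3, by omega⟩
    · rw [(hplay k).1 le_rfl] at hev ⊢
      exact ⟨rfl, rfl, hlegal _ k (hproj P _ k hP (by omega)) hev⟩
    · rw [((hplay k).2.1 le_rfl).1]
      exact ⟨rfl, rfl, rfl⟩
    · rw [(hplay k).2.2 le_rfl]
      have hedge := ((hplay k).2.1 (by omega)).2.1
      refine ⟨rfl, hout _ (k + 1) (hproj P _ _ hP (by omega)) _ _ rfl rfl k k.lt_succ_self,
        _, ?_, rfl⟩
      unfold Recordable
      rw [edgePriority_val hedge]
      split_ifs with h
      · rfl
      · exact ⟨Nat.not_even_iff_odd.1 h, le_rfl⟩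
  · have hplay := fun k => play_of_regStrategy (hP (3 * k + 3)) _ rfl _ _ rfl rfl
    rw [← parityAccepting_blockSup (by norm_num : 0 < 3)]
    have h := hacc (G.projectPlay P) (fun K => hproj P (3 * K) K (hP _) (by omega)) _ _ rfl rfl
    convert h using 2 with k
    have h0 := (hplay k k).1 (by omega)
    have h1 := ((hplay k k).2.1 (by omega)).1
    have h2 := (hplay k k).2.2 (by omega)
    have l0 : (Reg J n G).label (P (3 * k)) (P (3 * k + 1)) = J.lo := by rw [h0]; rfl
    have l1 : (Reg J n G).label (P (3 * k + 1)) (P (3 * k + 2)) = J.lo := by rw [h1]; rfl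
    have hlo := (label_mem _ _ _ ((hP (3 * k + 3)).2 (3 * k + 2) (by omega)).1).1
    have l2 : ∀ u w (c : RegConfig I J n) j x, (Reg J n G).label (.chosen u w c j) x = c.output j :=
      fun _ _ _ _ _ => rfl
    rw [h2, l2] at hlo
    simp only [blockSup, Finset.range_add_one, Finset.range_zero, Finset.sup_insert,
      Finset.sup_empty, Nat.add_zero, Nat.add_assoc, Nat.reduceAdd, l0, l1, Nat.bot_eq_zero]
    rw [h2, l2]
    omega

end ParityGame

/-! ### Characterisation of feasibility -/

theorem sup_Ico_interleave (c : ℕ) (f : ℕ → ℕ) (hc : ∀ k, c ≤ f k) {u v e : ℕ} (huv : u < v)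
    (he : e < 2) : (Finset.Ico (2 * u + e) (2 * v + e)).sup (interleave (fun _ => c) f) =
      (Finset.Ico u v).sup f := by
  refine le_antisymm (Finset.sup_le fun z hz => ?_) (Finset.sup_le fun w hw => ?_)
  · have hz := Finset.mem_Ico.1 hz
    rcases Nat.even_or_odd' z with ⟨w, rfl | rfl⟩
    · rw [interleave_even]
      exact (hc u).trans (Finset.le_sup (Finset.mem_Ico.2 ⟨le_rfl, huv⟩))
    · rw [interleave_odd]
      exact Finset.le_sup (f := f) (Finset.mem_Ico.2 ⟨by omega, by omega⟩)
  · have hw := Finset.mem_Ico.1 hw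
    rw [← interleave_odd (fun _ => c) f w]
    exact Finset.le_sup (Finset.mem_Ico.2 ⟨by omega, by omega⟩)

theorem interleave_val {X : Index} (f g : ℕ → X.Priority) :
    (fun z => (interleave f g z).1) = interleave (fun k => (f k).1) fun k => (g k).1 := by
  funext z
  unfold interleave
  split_ifs <;> rfl

namespace TreeAutomaton

variable {α : Type*} {I J : Index}

/-- The priorities given by the run `ρ` to the moves of the acceptance game of another automaton
on the same tree. -/
noncomputable def movePriority (A : TreeAutomaton α I) {B : TreeAutomaton α J} (ρ : LTree B.trans) :
    List Bool × (A.Q ⊕ A.trans) → List Bool × (A.Q ⊕ A.trans) → J.Priority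
  | (w, .inr _), (w', _) => B.prio (ρ w) (decide (w' = w ++ [true]))
  | (_, .inl _), _ => ⟨J.lo, le_rfl, J.lo_le_hi⟩

theorem priorities_of_play {A : TreeAutomaton α I} {B : TreeAutomaton α J} {t : LTree α}
    {ρ : LTree B.trans} {π : LTree A.trans} (hπ : A.IsRun t π)
    {p : ℕ → List Bool × (A.Q ⊕ A.trans)} {n : ℕ}
    (hp : (A.acceptanceGame t).PositionallyConsistent (A.followRun π) p n) {k : ℕ} (hk : k < n) :
    (A.acceptanceGame t).edgePriority (p k) (p (k + 1)) =
      interleave (fun _ => ⟨I.lo, le_rfl, I.lo_le_hi⟩)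
        (fun i => A.prio (π (branchPrefix (A.playBranch p) i)) (A.playBranch p i)) k ∧
    A.movePriority ρ (p k) (p (k + 1)) =
      interleave (fun _ => ⟨J.lo, le_rfl, J.lo_le_hi⟩)
        (fun i => B.prio (ρ (branchPrefix (A.playBranch p) i)) (A.playBranch p i)) k := by
  have hplay := play_of_followRun hπ hp
  have hlabel := ParityGame.edgePriority_val (hp.2 k hk).1
  rcases Nat.even_or_odd' k with ⟨i, rfl | rfl⟩
  · rw [interleave_even, interleave_even]
    have h0 := (hplay i).1 (by omega)
    refine ⟨Subtype.ext (hlabel.trans ?_), ?_⟩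
    · rw [h0]
      rfl
    · rw [h0]
      rfl
  · rw [interleave_odd, interleave_odd]
    have h0 := (hplay i).2 (by omega)
    have h1 := (hplay (i + 1)).1 (by omega)
    rw [branchPrefix_succ] at h1
    rw [show 2 * (i + 1) = 2 * i + 1 + 1 by ring] at h1
    refine ⟨Subtype.ext (hlabel.trans ?_), ?_⟩
    · rw [h0, h1]
      exact A.gameLabel_adam _ _ _
        (.inl (A.src (π (branchPrefix (A.playBranch p) i ++ [A.playBranch p i]))))
    · rw [h0, h1]
      simp [movePriority]

/-- The loop property along branches of the tree becomes a `LoopCondition` along plays, where each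
node accounts for two moves; hence the factor `2` in the bound. -/
theorem Reg_eveWins_of_run {A : TreeAutomaton α I} {B : TreeAutomaton α J} {t : LTree α} {n : ℕ}
    {S : Type*} [Finite S] (hn : 2 * Nat.card S < n) {π : LTree A.trans} (hπ : A.IsRun t π)
    {ρ : LTree B.trans}
    (hρ : ∀ β, ParityAccepting fun k => (B.prio (ρ (branchPrefix β k)) (β k) : ℕ))
    (s : List Bool → S)
    (hloop : ∀ β x y, x < y → s (branchPrefix β x) = s (branchPrefix β y) →
      Even ((Finset.Ico x y).sup fun z => (B.prio (ρ (branchPrefix β z)) (β z)).1) →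
      Even ((Finset.Ico x y).sup fun z => (A.prio (π (branchPrefix β z)) (β z)).1)) :
    (Reg J n (A.acceptanceGame t)).EveWins := by
  let a : (ℕ → Bool) → ℕ → I.Priority := fun β => interleave (fun _ => ⟨I.lo, le_rfl, I.lo_le_hi⟩)
    fun i => A.prio (π (branchPrefix β i)) (β i)
  let b : (ℕ → Bool) → ℕ → J.Priority := fun β => interleave (fun _ => ⟨J.lo, le_rfl, J.lo_le_hi⟩)
    fun i => B.prio (ρ (branchPrefix β i)) (β i)
  -- The Boolean tells Eve's moves from Adam's, so that a repetition in the play spans whole tree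
  -- levels.
  let σ : (ℕ → Bool) → ℕ → S × Bool := fun β =>
    interleave (fun i => (s (branchPrefix β i), false)) fun i => (s (branchPrefix β i), true)
  have hcard : Nat.card (S × Bool) < n := by
    rw [Nat.card_prod, Nat.card_eq_fintype_card (α := Bool), Fintype.card_bool]
    omega
  have hcond : ∀ β K,
      RegConfig.LoopCondition (σ β) (fun z => (a β z).1) (fun z => (b β z).1) K := by
    intro β K x y hxy _ hs hb
    have hshape : ∃ u v e, e < 2 ∧ x = 2 * u + e ∧ y = 2 * v + e ∧
        s (branchPrefix β u) = s (branchPrefix β v) := by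
      rcases Nat.even_or_odd' x with ⟨u, rfl | rfl⟩ <;>
        rcases Nat.even_or_odd' y with ⟨v, rfl | rfl⟩ <;>
        simp only [σ, interleave_even, interleave_odd, Prod.mk.injEq, Bool.false_eq_true,
          Bool.true_eq_false, and_false, and_true] at hs
      · exact ⟨u, v, 0, by omega, rfl, rfl, hs⟩
      · exact ⟨u, v, 1, by omega, rfl, rfl, hs⟩
    obtain ⟨u, v, e, he, rfl, rfl, hs'⟩ := hshape
    have huv : u < v := by omega
    simp only [a, b, interleave_val] at hb ⊢
    rw [sup_Ico_interleave _ _ (fun k => (B.prio _ _).2.1) huv he] at hb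
    rw [sup_Ico_interleave _ _ (fun k => (A.prio _ _).2.1) huv he]
    exact hloop β u v huv hs' hb
  refine ParityGame.Reg_eveWins _ (A.followRun π) (A.movePriority ρ)
    (fun p k hp hv => edge_followRun hπ hp hv) ?_ ?_
  · rintro p K hp a' b' rfl rfl k hk
    have heq := fun i (hi : i < K) => priorities_of_play (ρ := ρ) hπ hp hi
    have h := RegConfig.output_follow_mem (s := σ (A.playBranch p)) hcard
      (hcond (A.playBranch p) K) hk
    have h1 : RegConfig.follow n _ _ k = RegConfig.follow n (a (A.playBranch p))
      (b (A.playBranch p)) k := RegConfig.follow_congr fun i hi => heq i (by omega)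
    unfold RegConfig.followChoice at h ⊢
    simp only [h1, (heq k hk).1, (heq k hk).2]
    exact h
  · rintro p hp a' b' rfl rfl
    have heq := fun i => priorities_of_play (ρ := ρ) hπ (hp (i + 1)) i.lt_succ_self
    have ha := funext fun i => (heq i).1
    have hb := funext fun i => (heq i).2
    rw [ha, hb]
    refine RegConfig.parityAccepting_output_follow (s := σ (A.playBranch p)) hcard
      (hcond (A.playBranch p)) ?_
    rw [interleave_val, ← parityAccepting_blockSup two_pos]
    have h := hρ (A.playBranch p)
    convert h using 2 with k
    rw [blockSup_interleave]
    exact max_eq_right (B.prio _ _).2.1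

/-- If the language of a guidable automaton is feasible, Eve wins the priority transduction game on
every tree of the language, with a uniform bound on the counters. -/
theorem exists_Reg_eveWins_of_feasible (A : TreeAutomaton α I) (hA : A.IsGuidable)
    (h : Feasible J A.language) :
    ∃ n, ∀ t ∈ A.language, (Reg J n (A.acceptanceGame t)).EveWins := by
  obtain ⟨B, hB⟩ := h
  -- `J` may have no odd priority for the sink; the extra `J.hi + 1` supplies one. It does not
  -- affect the outputs, since the accepting run used below comes from `B`, with priorities in `J`.
  let K : Index := ⟨J.lo, J.hi + 1, J.lo_le_hi.trans (Nat.le_succ _)⟩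
  obtain ⟨p, hp⟩ : ∃ p : K.Priority, Odd p.1 := by
    rcases Nat.even_or_odd J.hi with h | h
    · exact ⟨⟨J.hi + 1, K.lo_le_hi, le_rfl⟩, h.add_one⟩
    · exact ⟨⟨J.hi, J.lo_le_hi, Nat.le_succ _⟩, h⟩
  have hlo : K.lo ≤ J.lo := le_rfl
  have hhi : J.hi ≤ K.hi := Nat.le_succ _
  obtain ⟨g, hgf, hg⟩ := hA K (B.completion K hlo hhi p) (B.completion_isComplete hlo hhi p)
    ((B.completion_language hlo hhi p hp).trans hB)
  have hfin := A.finite_Q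
  have hfin' := (B.completion K hlo hhi p).finite_Q
  -- Pumping needs both the guided state of `A` and the state of the completion to repeat, so the
  -- memory is the product. This bound does not depend on `t`.
  refine ⟨2 * Nat.card (A.Q × (B.completion K hlo hhi p).Q) + 1, fun t ht => ?_⟩
  rw [← hB] at ht
  obtain ⟨ρ, hρ⟩ := exists_isAcceptingRun_of_mem_language ht
  have hρ' := (B.isAcceptingRun_embed_iff hlo hhi p).2 hρ
  refine Reg_eveWins_of_run (Nat.lt_succ_self _) (hg _ _ hρ').1 hρ.2
    (fun w => (guidedState A _ g A.init (fun w => B.embed hlo hhi p (ρ w)) w,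
      (B.completion K hlo hhi p).src (B.embed hlo hhi p (ρ w)))) fun β x y hxy hs hev => ?_
  rw [Prod.mk.injEq] at hs
  refine even_loop_of_guides hg hρ' hxy hs.2 hs.1 ?_
  simpa only [prio_embed] using hev

theorem mem_language_iff_Reg_eveWins (A : TreeAutomaton α I) {n : ℕ}
    (h : ∀ t ∈ A.language, (Reg J n (A.acceptanceGame t)).EveWins) (t : LTree α) :
    t ∈ A.language ↔ (Reg J n (A.acceptanceGame t)).EveWins :=
  ⟨h t, fun ht => A.regAutomaton_language_subset J n (A.mem_regAutomaton_language ht)⟩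

theorem feasible_iff_exists_Reg (A : TreeAutomaton α I) (hA : A.IsGuidable) (J : Index) :
    Feasible J A.language ↔
      ∃ n : ℕ, ∀ t : LTree α, t ∈ A.language ↔ (Reg J n (A.acceptanceGame t)).EveWins := by
  constructor
  · intro h
    obtain ⟨n, hn⟩ := A.exists_Reg_eveWins_of_feasible hA h
    exact ⟨n, A.mem_language_iff_Reg_eveWins hn⟩
  · rintro ⟨n, hn⟩
    exact ⟨A.regAutomaton J n, Set.Subset.antisymm (A.regAutomaton_language_subset J n)
      fun t ht => A.mem_regAutomaton_language ((hn t).1 ht)⟩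

end TreeAutomaton

/-- Any `J` other than a single even priority contains an odd one, which the sink can use without
enlarging the index. -/
theorem completelyFeasible_iff_feasible {α : Type*} {J : Index}
    (hJ : ¬ (J.lo = J.hi ∧ Even J.lo)) (L : Set (LTree α)) :
    CompletelyFeasible J L ↔ Feasible J L := by
  constructor
  · rintro ⟨B, -, hB⟩
    exact ⟨B, hB⟩
  · rintro ⟨B, hB⟩
    obtain ⟨p, hp⟩ : ∃ p : J.Priority, Odd p.1 := by
      have hlohi := J.lo_le_hi
      rcases Nat.even_or_odd J.lo with h | h
      · exact ⟨⟨J.lo + 1, Nat.le_succ _, by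
          by_contra hlt
          exact hJ ⟨by omega, h⟩⟩, h.add_one⟩
      · exact ⟨⟨J.lo, le_rfl, hlohi⟩, h⟩
    exact ⟨B.completion J le_rfl le_rfl p, B.completion_isComplete _ _ p,
      (B.completion_language le_rfl le_rfl p hp).trans hB⟩

theorem theorem1 {α : Type*} [Finite α] [Nonempty α] {I : Index} (A : TreeAutomaton α I)
    (hcomplete : A.IsComplete) (hguidable : A.IsGuidable) (J : Index) :
    (Feasible J A.language ↔
      ∃ n : ℕ, ∀ t : LTree α,
        t ∈ A.language ↔ (Reg J n (A.acceptanceGame t)).EveWins) ∧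
    ((¬ (J.lo = J.hi ∧ Even J.lo)) →
      (CompletelyFeasible J A.language ↔
        ∃ n : ℕ, ∀ t : LTree α,
          t ∈ A.language ↔ (Reg J n (A.acceptanceGame t)).EveWins)) :=
  ⟨A.feasible_iff_exists_Reg hguidable J, fun hJ =>
    (completelyFeasible_iff_feasible hJ _).trans (A.feasible_iff_exists_Reg hguidable J)⟩
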